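/- **Protocol.** There are $n$ nodes and slots $t=1,2,\dots$; a set of $f$ nodes, fixed in advance, is adversarial and always awake, the others are honest. Signatures and hash pointers are ideal, so a block determines its chain back to genesis; let $\preceq$ be the prefix relation on chains. Each node wins each slot independently with probability $p$. *Longest-chain protocol $\Pi_{\mathrm{lc}}$ (Sleepy).* A chain is valid if each non-genesis block was made by a node that won the slot of the block and slots strictly increase along the chain. An honest node awake in slot $t$ takes a longest valid chain it knows with slot numbers below $t$ (ties broken arbitrarily); if it won slot $t$ it appends one block and broadcasts it. Its output $\mathsf{ch}_i^t$ is its longest chain without the last $k=\lceil\kappa\sigma\rceil$ blocks (genesis is never removed), where $\kappa>0$ is a constant and $\sigma$ the security parameter. *BFT protocol $\Pi_{\mathrm{bft}}$ (Streamlet, modified).* Epochs last $2\Delta$ slots and each has a leader. At the start of an epoch the leader proposes a BFT block that extends a longest notarized chain in its view and references the tip of its current $\mathsf{ch}$. $\Delta$ slots later, every awake honest node takes the first valid proposal of the epoch (signed by the leader and extending a longest notarized chain in the view of the node), and votes for it if and only if the chain referenced by the proposal is $\preceq$ its own current $\mathsf{ch}$. A BFT block is notarized in a view if at least $2n/3$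 nodes have voted for it; on a notarized chain with strictly increasing epochs, the middle one of three adjacent blocks from consecutive epochs is final, together with its prefix (genesis is final, with epoch $0$). Each awake honest node outputs some final BFT chain of its view; if final chains conflict, any of them may be output. The finalized ledger $\mathsf{LOG}_{\mathrm{fin},i}^t$ is the concatenation of the chains referenced along this BFT chain, keeping only the first occurrence of each block. Awake honest nodes echo what they receive. Asleep nodes do nothing and keep their state. **Adversary.** In every slot at least one honest node is awake and at most a fraction $\beta<\tfrac12$ of the awake nodes is adversarial. (If adversarial nodes are always a strict minority of the awake nodes, this holds with $\beta=f/(2f+1)$.) Every message sent or echoed by an awake honest node reaches every honest node within $\Delta\ge1$ slots, or in its first awake slot after that. The set of honest nodes awake in slot $t$ may depend on all lottery outcomes of adversarial nodes, on the lottery outcomes of honest nodes before slot $t$, and on further randomness, but is chosen from information independent of the honest lottery outcomes from slot $t$ on. Everything else (delays, adversarial messages, ties, leaders, transactions) may depend arbitrarily on all randomness. No bound on $f/n$ beyond the above is assumed, so $\Pi_{\mathrm{bft}}$ may fork. **Lemma.** Let $\Delta\ge1$, $0\le\beta<\tfrac12$, $0<p<\dfrac{1-2\beta}{2\Delta n(1-\beta)}$,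 $\kappa>0$, and let $T$ be a polynomial with natural number coefficients. There is a constant $c>0$, depending only on $n,\Delta,\beta,p,\kappa,T$, such that for all sufficiently large $\sigma$, uniformly over all adversaries as above, the following hold simultaneously except with probability at most $e^{-c\sqrt\sigma}$, for all honest nodes $i,j$ (awake or asleep) and all times $t,t'\le T(\sigma)$: 1. $\mathsf{LOG}_{\mathrm{fin},i}^t\preceq \mathsf{ch}_i^t$; 2. $\mathsf{LOG}_{\mathrm{fin},i}^t\preceq \mathsf{ch}_j^{t'}$ or $\mathsf{ch}_j^{t'}\preceq\mathsf{LOG}_{\mathrm{fin},i}^t$; 3. $\mathsf{LOG}_{\mathrm{fin},i}^t\preceq \mathsf{LOG}_{\mathrm{fin},j}^{t'}$ or $\mathsf{LOG}_{\mathrm{fin},j}^{t'}\preceq\mathsf{LOG}_{\mathrm{fin},i}^t$. -/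

import Mathlib

open MeasureTheory ProbabilityTheory Filter

universe u v

namespace SnapChat

/-! ## Blocks, chains, messages -/

/-- A block of the longest-chain protocol. Hash pointers are ideal: a block contains its parent, so
it identifies its whole chain back to genesis. -/
inductive LcBlock (n : ℕ) (Tx : Type u) : Type u
  | genesis : LcBlock n Tx
  | cons (parent : LcBlock n Tx) (slot : ℕ) (miner : Fin n) (txs : List Tx) : LcBlock n Tx

/-- A block of the BFT protocol. Its payload is a reference to a longest-chain block, which stands
for the snapshot ending in that block; the genesis block has no payload. -/
inductive BftBlock (n : ℕ) (Tx : Type u) : Type u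
  | genesis : BftBlock n Tx
  | cons (parent : BftBlock n Tx) (epoch : ℕ) (payload : LcBlock n Tx) : BftBlock n Tx

variable {n : ℕ} {Tx : Type u}

namespace LcBlock

/-- The chain identified by a block, from genesis to the block. -/
def chain : LcBlock n Tx → List (LcBlock n Tx)
  | genesis => [genesis]
  | cons q s i x => q.chain ++ [cons q s i x]

/-- Length of the chain, not counting genesis. -/
def depth : LcBlock n Tx → ℕ
  | genesis => 0
  | cons q _ _ _ => q.depth + 1

def slot : LcBlock n Tx → ℕ
  | genesis => 0
  | cons _ s _ _ => s

def parent : LcBlock n Tx → LcBlock n Tx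
  | genesis => genesis
  | cons q _ _ _ => q

/-- `b ≼ b'`: the chain of `b` is a prefix of the chain of `b'`. -/
def IsPrefix (b b' : LcBlock n Tx) : Prop := b.chain <+: b'.chain

/-- Every block on the chain was produced by a node holding a winning ticket for the slot of the
block, and slots strictly increase along the chain. -/
def Valid (win : Fin n → ℕ → Prop) : LcBlock n Tx → Prop
  | genesis => True
  | cons q s i _ => win i s ∧ q.slot < s ∧ q.Valid win

/-- Remove the last `k` blocks of the chain (never genesis). -/
def truncate (k : ℕ) (b : LcBlock n Tx) : LcBlock n Tx := parent^[k] b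

end LcBlock

namespace BftBlock

def chain : BftBlock n Tx → List (BftBlock n Tx)
  | genesis => [genesis]
  | cons q e b => q.chain ++ [cons q e b]

def depth : BftBlock n Tx → ℕ
  | genesis => 0
  | cons q _ _ => q.depth + 1

/-- Epochs are numbered from `1`; genesis has epoch `0`. -/
def epoch : BftBlock n Tx → ℕ
  | genesis => 0
  | cons _ e _ => e

def IsPrefix (B B' : BftBlock n Tx) : Prop := B.chain <+: B'.chain

/-- The snapshots ordered by the chain of a BFT block, each given by its tip. -/
def snapshots : BftBlock n Tx → List (LcBlock n Tx)
  | genesis => []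
  | cons q _ b => q.snapshots ++ [b]

end BftBlock

/-- Network messages: a longest-chain block (with its chain), a block proposal signed by a node, a
vote for a block signed by a node. -/
inductive Msg (n : ℕ) (Tx : Type u) : Type u
  | lc (b : LcBlock n Tx) : Msg n Tx
  | proposal (B : BftBlock n Tx) (signer : Fin n) : Msg n Tx
  | vote (B : BftBlock n Tx) (signer : Fin n) : Msg n Tx

/-! ## Rules evaluated on a set `V` of messages known to a node -/

/-- `b` is a candidate chain in slot `t`: it is genesis, or a block on a received chain, it is valid,
and it carries a slot number below `t`. -/
def IsCandidate (win : Fin n → ℕ → Prop) (V : Set (Msg n Tx)) (t : ℕ) (b : LcBlock n Tx) : Prop :=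
  (b = LcBlock.genesis ∨ ∃ b', Msg.lc b' ∈ V ∧ b.IsPrefix b') ∧ b.Valid win ∧ b.slot < t

/-- `b` is the tip of a longest candidate chain (ties may be broken in any way). -/
def IsLongest (win : Fin n → ℕ → Prop) (V : Set (Msg n Tx)) (t : ℕ) (b : LcBlock n Tx) : Prop :=
  IsCandidate win V t b ∧ ∀ b', IsCandidate win V t b' → b'.depth ≤ b.depth

/-- At least two thirds of all `n` nodes voted for `B`. -/
def Notarized (V : Set (Msg n Tx)) (B : BftBlock n Tx) : Prop :=
  2 * n ≤ 3 * Set.ncard {i : Fin n | Msg.vote B i ∈ V}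

/-- All blocks on the chain other than genesis are notarized, and epochs strictly increase. -/
def NotarizedChain (V : Set (Msg n Tx)) : BftBlock n Tx → Prop
  | BftBlock.genesis => True
  | BftBlock.cons q e b => Notarized V (BftBlock.cons q e b) ∧ q.epoch < e ∧ NotarizedChain V q

def IsLongestNotarized (V : Set (Msg n Tx)) (B : BftBlock n Tx) : Prop :=
  NotarizedChain V B ∧ ∀ B', NotarizedChain V B' → B'.depth ≤ B.depth

/-- Out of three adjacent blocks of consecutive epochs on a notarized chain, the middle one is final
together with its prefix. Genesis is final. -/
def IsFinal (V : Set (Msg n Tx)) (B : BftBlock n Tx) : Prop :=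
  B = BftBlock.genesis ∨
    ∃ (B₀ : BftBlock n Tx) (b₁ b₂ : LcBlock n Tx),
      NotarizedChain V
        (BftBlock.cons (BftBlock.cons B₀ (B₀.epoch + 1) b₁) (B₀.epoch + 2) b₂) ∧
      B.IsPrefix (BftBlock.cons B₀ (B₀.epoch + 1) b₁)

/-! ## Epochs: slots `1, 2, 3, …`, epochs of `2 * Δ` slots, votes `Δ` slots into the epoch -/

def epochOf (Δ t : ℕ) : ℕ := (t - 1) / (2 * Δ) + 1

def IsProposeSlot (Δ t : ℕ) : Prop := (t - 1) % (2 * Δ) = 0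

def IsVoteSlot (Δ t : ℕ) : Prop := (t - 1) % (2 * Δ) = Δ

/-! ## Executions -/

/-- The data of one execution. Entries of `recv`, `sent`, `lcTip`, `bftTip` that belong to
adversarial nodes carry no meaning. -/
structure Execution (n : ℕ) (Tx : Type u) where
  /-- the honest nodes that are awake in a slot -/
  awake : ℕ → Finset (Fin n)
  /-- leader of each epoch -/
  leader : ℕ → Fin n
  /-- transactions held by a node in a slot, supplied by the environment -/
  txs : Fin n → ℕ → List Tx
  /-- all messages that node `i` has received from the network and processed by the start of its
  slot `t` -/
  recv : Fin n → ℕ → Set (Msg n Tx)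
  /-- messages newly created and broadcast by a node in a slot; echoes are not listed here -/
  sent : Fin n → ℕ → Set (Msg n Tx)
  /-- tip of the longest chain that a node holds at the end of a slot -/
  lcTip : Fin n → ℕ → LcBlock n Tx
  /-- tip of the finalized BFT chain that a node outputs at the end of a slot -/
  bftTip : Fin n → ℕ → BftBlock n Tx

namespace Execution

variable (E : Execution n Tx)

/-- What node `i` knows during slot `t`, before its own messages of that slot. -/
def viewBefore (i : Fin n) (t : ℕ) : Set (Msg n Tx) :=
  E.recv i t ∪ {m | ∃ s < t, m ∈ E.sent i s}

/-- What node `i` knows at the end of slot `t`. -/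
def view (i : Fin n) (t : ℕ) : Set (Msg n Tx) :=
  E.recv i t ∪ {m | ∃ s ≤ t, m ∈ E.sent i s}

/-- Tip of the confirmed chain: the last `k` blocks of the longest chain are unconfirmed. -/
def confirmed (k : ℕ) (i : Fin n) (t : ℕ) : LcBlock n Tx := (E.lcTip i t).truncate k

/-- Output of the longest-chain protocol. -/
def chLc (k : ℕ) (i : Fin n) (t : ℕ) : List (LcBlock n Tx) := (E.confirmed k i t).chain

/-- Longest-chain part of a slot. A node with a winning ticket extends the tip of a longest chain
by one block and broadcasts it. -/
def LcRule (win : Fin n → ℕ → Prop) (i : Fin n) (t : ℕ) : Prop :=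
  ∃ b, IsLongest win (E.viewBefore i t) t b ∧
    (win i t → E.lcTip i t = LcBlock.cons b t i (E.txs i t)) ∧
    (¬ win i t → E.lcTip i t = b) ∧
    ∀ b', Msg.lc b' ∈ E.sent i t ↔ win i t ∧ b' = E.lcTip i t

/-- At the start of an epoch its leader, and nobody else, proposes a block that extends the tip of a
longest notarized chain and whose payload is the leader's confirmed chain. -/
def ProposeRule (Δ k : ℕ) (i : Fin n) (t : ℕ) : Prop :=
  (IsProposeSlot Δ t ∧ E.leader (epochOf Δ t) = i →
    ∃ B, IsLongestNotarized (E.viewBefore i t) B ∧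
      ∀ B' j, Msg.proposal B' j ∈ E.sent i t ↔
        j = i ∧ B' = BftBlock.cons B (epochOf Δ t) (E.confirmed k i t)) ∧
  (¬ (IsProposeSlot Δ t ∧ E.leader (epochOf Δ t) = i) →
    ∀ B' j, Msg.proposal B' j ∉ E.sent i t)

/-- In the view of `i` in slot `t`, the block with parent `q` and payload `b` is validly proposed
for the current epoch: proposed by the leader, and extending a longest notarized chain. -/
def ValidProposal (Δ : ℕ) (i : Fin n) (t : ℕ) (q : BftBlock n Tx) (b : LcBlock n Tx) : Prop :=
  Msg.proposal (BftBlock.cons q (epochOf Δ t) b) (E.leader (epochOf Δ t)) ∈ E.viewBefore i t ∧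
    q.epoch < epochOf Δ t ∧ IsLongestNotarized (E.viewBefore i t) q

/-- A valid proposal such that none of the others was known in an earlier slot than it. -/
def FirstValidProposal (Δ : ℕ) (i : Fin n) (t : ℕ) (q : BftBlock n Tx) (b : LcBlock n Tx) : Prop :=
  E.ValidProposal Δ i t q b ∧
    ∀ s < t, ∀ q' b', E.ValidProposal Δ i t q' b' →
      Msg.proposal (BftBlock.cons q' (epochOf Δ t) b') (E.leader (epochOf Δ t)) ∈ E.view i s →
      Msg.proposal (BftBlock.cons q (epochOf Δ t) b) (E.leader (epochOf Δ t)) ∈ E.view i s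

/-- In the voting slot of an epoch a node votes for the first valid proposal if it sees the
referenced snapshot as confirmed; it casts no other votes. -/
def VoteRule (Δ k : ℕ) (i : Fin n) (t : ℕ) : Prop :=
  (IsVoteSlot Δ t ∧ (∃ q b, E.ValidProposal Δ i t q b) →
    ∃ q b, E.FirstValidProposal Δ i t q b ∧
      ∀ B j, Msg.vote B j ∈ E.sent i t ↔
        j = i ∧ B = BftBlock.cons q (epochOf Δ t) b ∧ b.IsPrefix (E.confirmed k i t)) ∧
  (¬ (IsVoteSlot Δ t ∧ ∃ q b, E.ValidProposal Δ i t q b) →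
    ∀ B j, Msg.vote B j ∉ E.sent i t)

/-- Remove all but the first occurrence of each element. -/
noncomputable def sanitize {α : Type*} (l : List α) : List α :=
  open Classical in l.foldl (fun acc a => if a ∈ acc then acc else acc ++ [a]) []

/-- The finalized ledger: the chains of all snapshots ordered by the finalized BFT chain are
concatenated and the result is sanitized. -/
noncomputable def logFin (i : Fin n) (t : ℕ) : List (LcBlock n Tx) :=
  sanitize ((E.bftTip i t).snapshots.flatMap LcBlock.chain)

end Execution

/-- `E` is an execution of the snap-and-chat protocol built from Sleepy (with winning tickets `win`
and confirmation depth `k`) and Streamlet, with the nodes in `corrupt` adversarial, in a network of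
delay at most `Δ`. -/
structure IsExecution (corrupt : Finset (Fin n)) (Δ k : ℕ) (win : Fin n → ℕ → Prop)
    (E : Execution n Tx) : Prop where
  awake_honest : ∀ t, ∀ i ∈ E.awake t, i ∉ corrupt
  /-- initial state -/
  init : ∀ i, i ∉ corrupt → E.recv i 0 = ∅ ∧ E.sent i 0 = ∅ ∧
    E.lcTip i 0 = LcBlock.genesis ∧ E.bftTip i 0 = BftBlock.genesis
  /-- a sleeping node receives nothing, sends nothing and keeps its state -/
  asleep : ∀ i, i ∉ corrupt → ∀ t, i ∉ E.awake (t + 1) →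
    E.recv i (t + 1) = E.recv i t ∧ E.sent i (t + 1) = ∅ ∧
    E.lcTip i (t + 1) = E.lcTip i t ∧ E.bftTip i (t + 1) = E.bftTip i t
  recv_mono : ∀ i, i ∉ corrupt → Monotone (E.recv i)
  /-- whatever an awake honest node sends or receives (and hence echoes) reaches every honest
  node within `Δ` slots, or when that node next wakes up -/
  delivery : ∀ i j s t, j ∈ E.awake s → i ∈ E.awake t → s + Δ ≤ t →
    E.recv j s ∪ E.sent j s ⊆ E.recv i t
  /-- signatures of honest nodes cannot be forged -/
  auth_lc : ∀ i, i ∉ corrupt → ∀ t b, Msg.lc b ∈ E.recv i t →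
    ∀ q s j x, (LcBlock.cons q s j x).IsPrefix b → j ∉ corrupt →
      ∃ r < t, Msg.lc (LcBlock.cons q s j x) ∈ E.sent j r
  auth_proposal : ∀ i, i ∉ corrupt → ∀ t B j, Msg.proposal B j ∈ E.recv i t → j ∉ corrupt →
    ∃ r < t, Msg.proposal B j ∈ E.sent j r
  auth_vote : ∀ i, i ∉ corrupt → ∀ t B j, Msg.vote B j ∈ E.recv i t → j ∉ corrupt →
    ∃ r < t, Msg.vote B j ∈ E.sent j r
  /-- an awake honest node follows the protocol -/
  lc_rule : ∀ t, 1 ≤ t → ∀ i ∈ E.awake t, E.LcRule win i t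
  propose_rule : ∀ t, 1 ≤ t → ∀ i ∈ E.awake t, E.ProposeRule Δ k i t
  vote_rule : ∀ t, 1 ≤ t → ∀ i ∈ E.awake t, E.VoteRule Δ k i t
  /-- it outputs some BFT chain that is final in its view; if final chains conflict, any of them
  may be output -/
  final_rule : ∀ t, 1 ≤ t → ∀ i ∈ E.awake t, IsFinal (E.view i t) (E.bftTip i t)

/-- In every slot at most a fraction `β` of the awake nodes is adversarial (adversarial nodes are
always awake), and at least one honest node is awake. -/
def HonestParticipation (corrupt : Finset (Fin n)) (β : ℝ) (E : Execution n Tx) : Prop :=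
  ∀ t, 1 ≤ t → (E.awake t).Nonempty ∧
    (corrupt.card : ℝ) ≤ β * ((corrupt.card : ℝ) + ((E.awake t).card : ℝ))

/-- The lottery: each node wins each slot with probability `p`, independently. `F t` is the
information on which the adversary's choice of the awake nodes of slot `t` may be based: it contains
all tickets of adversarial nodes, the tickets of honest nodes for the slots before `t`, and
possibly further randomness, but it is independent of the tickets of honest nodes for the slots
from `t` on. -/
structure IsLottery {Ω : Type v} [mΩ : MeasurableSpace Ω] (μ : Measure Ω)
    (corrupt : Finset (Fin n)) (p : ℝ) (F : Filtration ℕ mΩ) (win : Ω → Fin n → ℕ → Prop) :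
    Prop where
  corrupt_known : ∀ i ∈ corrupt, ∀ t, MeasurableSet[F 0] {ω | win ω i t}
  honest_adapted : ∀ i, i ∉ corrupt → ∀ t, MeasurableSet[F (t + 1)] {ω | win ω i t}
  prob : ∀ i t, μ {ω | win ω i t} = ENNReal.ofReal p
  indep : iIndepSet (fun x : Fin n × ℕ => {ω | win ω x.1 x.2}) μ
  unpredictable : ∀ t, Indep (F t)
    (MeasurableSpace.generateFrom {A | ∃ i, i ∉ corrupt ∧ ∃ s, t ≤ s ∧ A = {ω | win ω i s}}) μ

/-- A random execution under the synchronous adversary with dynamic participation: the awake nodes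
of slot `t` are chosen on the basis of `F t`; all other adversarial choices (message delays,
adversarial messages, tie-breaking, leaders, transactions) may depend on `ω` in any way. -/
structure IsSyncDynamicRun {Ω : Type v} [mΩ : MeasurableSpace Ω] (μ : Measure Ω)
    (corrupt : Finset (Fin n)) (β p : ℝ) (Δ k : ℕ) (F : Filtration ℕ mΩ)
    (win : Ω → Fin n → ℕ → Prop) (E : Ω → Execution n Tx) : Prop where
  lottery : IsLottery μ corrupt p F win
  awake_causal : ∀ t i, MeasurableSet[F t] {ω | i ∈ (E ω).awake t}
  participation : ∀ ω, HonestParticipation corrupt β (E ω)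
  execution : ∀ ω, IsExecution corrupt Δ k (win ω) (E ω)

/-- Up to time `H`: the finalized ledger of every honest node is a prefix of that node's
longest-chain output, it conflicts with no longest-chain output of any honest node at any time, and
the finalized ledgers of any two honest nodes at any two times do not conflict. -/
structure FinIsSafePrefix (corrupt : Finset (Fin n)) (k H : ℕ) (E : Execution n Tx) : Prop where
  isPrefix : ∀ i, i ∉ corrupt → ∀ t ≤ H, E.logFin i t <+: E.chLc k i t
  consistent : ∀ i j, i ∉ corrupt → j ∉ corrupt → ∀ t ≤ H, ∀ t' ≤ H,
    E.logFin i t <+: E.chLc k j t' ∨ E.chLc k j t' <+: E.logFin i t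
  safe : ∀ i j, i ∉ corrupt → j ∉ corrupt → ∀ t ≤ H, ∀ t' ≤ H,
    E.logFin i t <+: E.logFin j t' ∨ E.logFin j t' <+: E.logFin i t

end SnapChat

/-! Deterministic part. A convergence slot is one where an awake honest node wins and no other
honest ticket wins within distance less than `Δ`; the blocks of different convergence slots have
different depths. A pivot is a convergence slot around which convergence slots outnumber adversarial
slots on every interval. Suppose that some longest chain avoids the block of a pivot `s`, and go
back on it to its last honest block (or genesis). That block is older than `s`, and above it there
are only adversarial blocks, at most one per adversarial slot; but each convergence slot since then
has raised the longest chain by one, so the chain is too short (`isPrefix_of_isPivot`). Hence, if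
every window of `k` slots has a pivot, a chain without its last `k` blocks stays on the longest
chains of all awake honest nodes (`confirmed_isPrefix`).

Little is needed of the BFT protocol, which may fork. Adversarial nodes are fewer than half of all
nodes, so a notarized block carries an honest vote, and the voter saw the snapshot as confirmed.
Finality adds an honest vote from a later epoch, so the output is given at least `2 * Δ` slots after
the first vote; by then the longest chain of the node is at least as long as the voter's was. Each
snapshot on a final chain therefore lies on the confirmed chain of the node that outputs it, and so
does the sanitized ledger. Confirmed chains do not conflict, and all three claims follow
(`finIsSafePrefix`).

Probabilistic part. Each window of `k` slots must have a pivot. Although awake sets are adaptive,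
every slot has at least `h` awake honest nodes, and the law of "a unique honest winner among `h`
chosen awake nodes" does not depend on the choice; so the outcomes are independent over slots and of
the adversarial tickets (`iIndepFun_ticket`). Slots are cut into blocks of constant length `B`. The
bound on `p` says that `β / (1 - β) < 1 - 2 * Δ * n * p`, so convergence slots beat adversarial ones
on average, and for large `B` by at least one per block (`exists_counts`).

With constant probability a block is the centre of `2 * M + 1` perfect blocks beyond which no large
deficit ever occurs. This event is localized to a group of `2 * R + 1` blocks, so that disjoint
groups are independent and `N` groups all fail with probability at most `exp (-δ * N)`; deficits on
longer intervals have probability `exp (-η * (R - M))` each by a Chernoff bound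
(`exists_measure_no_blockPivot_le`). As `N * R * B` must fit into `k ≈ κ * σ` slots, both `N` and
`R` are of order `√σ`, whence the rate; the union bound over times up to `T(σ)` costs only
polynomial factors. -/

namespace SnapChat

variable {n : ℕ} {Tx : Type u}

/-! ### Prefixes, depths and slots of longest-chain blocks -/

namespace LcBlock

lemma exists_chain_eq_append (b : LcBlock n Tx) : ∃ l, b.chain = l ++ [b] := by
  cases b with
  | genesis => exact ⟨[], rfl⟩
  | cons q s i x => exact ⟨q.chain, rfl⟩

lemma chain_injective : Function.Injective (chain : LcBlock n Tx → List (LcBlock n Tx)) := by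
  intro a b h
  obtain ⟨l, hl⟩ := exists_chain_eq_append a
  obtain ⟨l', hl'⟩ := exists_chain_eq_append b
  rw [hl, hl'] at h
  simpa using (List.append_inj' h rfl).2

lemma IsPrefix.refl (b : LcBlock n Tx) : b.IsPrefix b := List.prefix_rfl

lemma IsPrefix.trans {a b c : LcBlock n Tx} (h : a.IsPrefix b) (h' : b.IsPrefix c) :
    a.IsPrefix c := List.IsPrefix.trans h h'

lemma isPrefix_cons_iff {a q : LcBlock n Tx} {s : ℕ} {i : Fin n} {x : List Tx} :
    a.IsPrefix (cons q s i x) ↔ a = cons q s i x ∨ a.IsPrefix q := by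
  unfold IsPrefix
  rw [show (cons q s i x).chain = q.chain ++ [cons q s i x] from rfl, List.prefix_concat_iff]
  refine or_congr ⟨fun h => chain_injective h, fun h => by rw [h]; rfl⟩ Iff.rfl

lemma isPrefix_genesis_iff {a : LcBlock n Tx} : a.IsPrefix genesis ↔ a = genesis := by
  refine ⟨fun h => ?_, fun h => h ▸ IsPrefix.refl _⟩
  cases a with
  | genesis => rfl
  | cons q s i x =>
    have := h.length_le
    obtain ⟨l, hl⟩ := exists_chain_eq_append q
    simp [chain, hl] at this

lemma isPrefix_cons_self (q : LcBlock n Tx) (s : ℕ) (i : Fin n) (x : List Tx) :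
    q.IsPrefix (cons q s i x) := isPrefix_cons_iff.2 (Or.inr (IsPrefix.refl _))

lemma genesis_isPrefix (b : LcBlock n Tx) : genesis.IsPrefix b := by
  induction b with
  | genesis => exact IsPrefix.refl _
  | cons q s i x ih => exact isPrefix_cons_iff.2 (Or.inr ih)

lemma IsPrefix.depth_le {a b : LcBlock n Tx} (h : a.IsPrefix b) : a.depth ≤ b.depth := by
  induction b with
  | genesis => rw [isPrefix_genesis_iff.1 h]
  | cons q s i x ih =>
    rcases isPrefix_cons_iff.1 h with rfl | h
    · exact le_rfl
    · exact (ih h).trans (Nat.le_succ _)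

lemma IsPrefix.eq_of_depth_le {a b : LcBlock n Tx} (h : a.IsPrefix b) (hd : b.depth ≤ a.depth) :
    a = b := by
  cases b with
  | genesis => exact isPrefix_genesis_iff.1 h
  | cons q s i x =>
    rcases isPrefix_cons_iff.1 h with rfl | h
    · rfl
    · have := h.depth_le
      simp only [depth] at hd
      omega

lemma isPrefix_total {a b c : LcBlock n Tx} (ha : a.IsPrefix c) (hb : b.IsPrefix c) :
    a.IsPrefix b ∨ b.IsPrefix a := List.prefix_or_prefix_of_prefix ha hb

lemma isPrefix_of_depth_le {a b c : LcBlock n Tx} (ha : a.IsPrefix c) (hb : b.IsPrefix c)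
    (h : a.depth ≤ b.depth) : a.IsPrefix b := by
  rcases isPrefix_total ha hb with h' | h'
  · exact h'
  · rw [h'.eq_of_depth_le h]; exact IsPrefix.refl _

lemma Valid.of_isPrefix {win : Fin n → ℕ → Prop} {a b : LcBlock n Tx} (hb : b.Valid win)
    (h : a.IsPrefix b) : a.Valid win := by
  induction b with
  | genesis => rwa [isPrefix_genesis_iff.1 h]
  | cons q s i x ih =>
    rcases isPrefix_cons_iff.1 h with rfl | h
    · exact hb
    · exact ih hb.2.2 h

lemma Valid.slot_le {win : Fin n → ℕ → Prop} {a b : LcBlock n Tx} (hb : b.Valid win)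
    (h : a.IsPrefix b) : a.slot ≤ b.slot := by
  induction b with
  | genesis => rw [isPrefix_genesis_iff.1 h]
  | cons q s i x ih =>
    rcases isPrefix_cons_iff.1 h with rfl | h
    · exact le_rfl
    · exact (ih hb.2.2 h).trans hb.2.1.le

lemma Valid.isPrefix_of_slot_lt {win : Fin n → ℕ → Prop} {a b c : LcBlock n Tx}
    (hc : c.Valid win) (ha : a.IsPrefix c) (hb : b.IsPrefix c) (h : a.slot < b.slot) :
    a.IsPrefix b := by
  rcases isPrefix_total ha hb with h' | h'
  · exact h'
  · exact absurd ((hc.of_isPrefix ha).slot_le h') (by omega)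

lemma parent_isPrefix (b : LcBlock n Tx) : b.parent.IsPrefix b := by
  cases b with
  | genesis => exact IsPrefix.refl _
  | cons q s i x => exact isPrefix_cons_self ..

lemma truncate_succ (k : ℕ) (b : LcBlock n Tx) : b.truncate (k + 1) = (b.truncate k).parent :=
  Function.iterate_succ_apply' ..

lemma truncate_isPrefix (k : ℕ) (b : LcBlock n Tx) : (b.truncate k).IsPrefix b := by
  induction k with
  | zero => exact IsPrefix.refl _
  | succ k ih => rw [truncate_succ]; exact (parent_isPrefix _).trans ih

lemma depth_truncate (k : ℕ) (b : LcBlock n Tx) : (b.truncate k).depth = b.depth - k := by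
  induction k with
  | zero => rfl
  | succ k ih =>
    rw [truncate_succ, Nat.sub_add_eq, ← ih]
    cases b.truncate k <;> rfl

lemma truncate_genesis (k : ℕ) : (genesis : LcBlock n Tx).truncate k = genesis :=
  isPrefix_genesis_iff.1 (truncate_isPrefix _ _)

/-- Slots strictly increase along a valid chain, so every removed block goes back at least one slot.
This turns confirmation by depth into a time window of `k` slots. -/
lemma Valid.truncate_slot {win : Fin n → ℕ → Prop} {b : LcBlock n Tx} (hb : b.Valid win) (k : ℕ) :
    b.truncate k = genesis ∨ (b.truncate k).slot + k ≤ b.slot := by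
  induction k with
  | zero => exact Or.inr le_rfl
  | succ k ih =>
    rw [truncate_succ]
    rcases ih with ih | ih
    · left; rw [ih]; rfl
    · have hv := hb.of_isPrefix (truncate_isPrefix k b)
      cases h : b.truncate k with
      | genesis => left; rfl
      | cons q s i x =>
        right
        rw [h] at hv ih
        have := hv.2.1
        simp only [parent, slot] at *
        omega

lemma depth_le_of_mem_chain {x b : LcBlock n Tx} (h : x ∈ b.chain) : x.depth ≤ b.depth := by
  induction b with
  | genesis => simp only [chain, List.mem_singleton] at h; rw [h]
  | cons q s i y ih =>
    simp only [chain, List.mem_append, List.mem_singleton] at h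
    rcases h with h | rfl
    · exact (ih h).trans (Nat.le_succ _)
    · exact le_rfl

lemma chain_nodup (b : LcBlock n Tx) : b.chain.Nodup := by
  induction b with
  | genesis => simp [chain]
  | cons q s i y ih =>
    refine List.nodup_append.2 ⟨ih, List.nodup_singleton _, ?_⟩
    rintro a ha c hc rfl
    rw [List.mem_singleton] at hc
    have := depth_le_of_mem_chain ha
    rw [hc] at this
    simp [depth] at this

end LcBlock

lemma IsCandidate.of_isPrefix {win : Fin n → ℕ → Prop} {V : Set (Msg n Tx)} {t : ℕ}
    {a b : LcBlock n Tx} (hb : IsCandidate win V t b) (h : a.IsPrefix b) :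
    IsCandidate win V t a := by
  refine ⟨?_, hb.2.1.of_isPrefix h, (hb.2.1.slot_le h).trans_lt hb.2.2⟩
  rcases hb.1 with rfl | ⟨b', hm, hp⟩
  · exact Or.inl (LcBlock.isPrefix_genesis_iff.1 h)
  · exact Or.inr ⟨b', hm, h.trans hp⟩

lemma IsCandidate.mono {win : Fin n → ℕ → Prop} {V V' : Set (Msg n Tx)} {t t' : ℕ}
    {b : LcBlock n Tx} (hb : IsCandidate win V t b) (hV : V ⊆ V') (ht : t ≤ t') :
    IsCandidate win V' t' b :=
  ⟨hb.1.imp_right fun ⟨b', hm, hp⟩ => ⟨b', hV hm, hp⟩, hb.2.1, hb.2.2.trans_le ht⟩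

/-! ### Pivots and safety of the longest chain -/

/-- Exactly one honest node wins in a slot around which no other honest ticket wins for less than
`Δ` slots on both sides, and this node is awake. -/
def IsConvergence (corrupt : Finset (Fin n)) (Δ : ℕ) (win : Fin n → ℕ → Prop)
    (E : Execution n Tx) (t : ℕ) : Prop :=
  ∃ i ∈ E.awake t, win i t ∧
    ∀ j, j ∉ corrupt → ∀ s, s < t + Δ → t < s + Δ → win j s → j = i ∧ s = t

/-- Some adversarial node wins in the slot. -/
def IsAdvSlot (corrupt : Finset (Fin n)) (win : Fin n → ℕ → Prop) (t : ℕ) : Prop :=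
  ∃ i ∈ corrupt, win i t

open Classical in
/-- A convergence opportunity such that convergence opportunities outnumber adversarial slots on
every interval around it up to the horizon `H`, with `Δ` extra slots for the adversary. -/
def IsPivot (corrupt : Finset (Fin n)) (Δ H : ℕ) (win : Fin n → ℕ → Prop)
    (E : Execution n Tx) (s : ℕ) : Prop :=
  1 ≤ s ∧ IsConvergence corrupt Δ win E s ∧
    ∀ a b, 1 ≤ a → a ≤ s → s ≤ b → b + Δ ≤ H →
      ((Finset.Icc a (b + Δ)).filter (IsAdvSlot corrupt win)).card <
        ((Finset.Icc a b).filter (IsConvergence corrupt Δ win E)).card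

namespace IsExecution

variable {corrupt : Finset (Fin n)} {Δ k : ℕ} {win : Fin n → ℕ → Prop} {E : Execution n Tx}

lemma awake_of_mem_sent (hE : IsExecution corrupt Δ k win E) {j : Fin n} (hj : j ∉ corrupt)
    {r : ℕ} {m : Msg n Tx} (hm : m ∈ E.sent j r) : j ∈ E.awake r ∧ 1 ≤ r := by
  cases r with
  | zero => rw [(hE.init j hj).2.1] at hm; exact hm.elim
  | succ r =>
    refine ⟨?_, by omega⟩
    by_contra h
    rw [(hE.asleep j hj r h).2.1] at hm
    exact hm.elim

/-- Delivery covers what is received by slot `s` or sent in it; messages that `j` sent earlier were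
sent in slots in which `j` was awake, and were delivered from there. -/
lemma view_subset_recv (hE : IsExecution corrupt Δ k win E) {i j : Fin n} {s t : ℕ}
    (hj : j ∈ E.awake s) (hi : i ∈ E.awake t) (h : s + Δ ≤ t) :
    E.view j s ⊆ E.recv i t := by
  rintro m (hm | ⟨s', hs', hm⟩)
  · exact hE.delivery i j s t hj hi h (Or.inl hm)
  · have := hE.awake_of_mem_sent (hE.awake_honest _ _ hj) hm
    exact hE.delivery i j s' t this.1 hi (by omega) (Or.inr hm)

lemma exists_base (hE : IsExecution corrupt Δ k win E) {i : Fin n} {t : ℕ} (hi : i ∈ E.awake t)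
    (ht : 1 ≤ t) : ∃ b, IsLongest win (E.viewBefore i t) t b ∧ b.IsPrefix (E.lcTip i t) ∧
      (E.lcTip i t).Valid win ∧ (E.lcTip i t).slot ≤ t := by
  obtain ⟨b, hb, hw, hn, -⟩ := hE.lc_rule t ht i hi
  refine ⟨b, hb, ?_⟩
  by_cases h : win i t
  · rw [hw h]
    exact ⟨LcBlock.isPrefix_cons_self .., ⟨h, hb.1.2.2, hb.1.2.1⟩, le_rfl⟩
  · rw [hn h]
    exact ⟨LcBlock.IsPrefix.refl _, hb.1.2.1, hb.1.2.2.le⟩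

/-- The longest-chain tip held at the end of a slot is known to all awake nodes after `Δ` slots. -/
lemma isCandidate_lcTip (hE : IsExecution corrupt Δ k win E) (hΔ : 1 ≤ Δ) {i j : Fin n} {s t : ℕ}
    (hj : j ∈ E.awake s) (hs : 1 ≤ s) (hi : i ∈ E.awake t) (h : s + Δ ≤ t) :
    IsCandidate win (E.viewBefore i t) t (E.lcTip j s) := by
  obtain ⟨b, hb, hw, hn, hm⟩ := hE.lc_rule s hs j hj
  have hsub : E.view j s ⊆ E.viewBefore i t :=
    (hE.view_subset_recv hj hi h).trans Set.subset_union_left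
  by_cases hwin : win j s
  · refine ⟨Or.inr ⟨E.lcTip j s, hsub (Or.inr ⟨s, le_rfl, (hm _).2 ⟨hwin, rfl⟩⟩),
      LcBlock.IsPrefix.refl _⟩, ?_⟩
    rw [hw hwin]
    exact ⟨⟨hwin, hb.1.2.2, hb.1.2.1⟩, by simp only [LcBlock.slot]; omega⟩
  · rw [hn hwin]
    refine hb.1.mono (Set.Subset.trans ?_ hsub) (by omega)
    rintro m (h | ⟨r, hr, h⟩)
    exacts [Or.inl h, Or.inr ⟨r, hr.le, h⟩]

lemma depth_lcTip_le (hE : IsExecution corrupt Δ k win E) (hΔ : 1 ≤ Δ) {i j : Fin n} {s t : ℕ}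
    (hj : j ∈ E.awake s) (hs : 1 ≤ s) (hi : i ∈ E.awake t) (h : s + Δ ≤ t) {b : LcBlock n Tx}
    (hb : IsLongest win (E.viewBefore i t) t b) : (E.lcTip j s).depth ≤ b.depth :=
  hb.2 _ (hE.isCandidate_lcTip hΔ hj hs hi h)

/-- Chain growth: after `Δ` slots a winner knows the tip of `j` and builds on a chain at least as
long. -/
lemma depth_lcTip_lt (hE : IsExecution corrupt Δ k win E) (hΔ : 1 ≤ Δ) {i j : Fin n} {s t : ℕ}
    (hj : j ∈ E.awake s) (hs : 1 ≤ s) (hi : i ∈ E.awake t) (h : s + Δ ≤ t) (hw : win i t) :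
    (E.lcTip j s).depth < (E.lcTip i t).depth := by
  obtain ⟨b, hb, hc, -⟩ := hE.lc_rule t (by omega) i hi
  rw [hc hw]
  exact Nat.lt_succ_of_le (hE.depth_lcTip_le hΔ hj hs hi h hb)

/-- Blocks of honest nodes on a candidate chain were produced by awake nodes that follow the
protocol. -/
lemma eq_lcTip_of_isPrefix (hE : IsExecution corrupt Δ k win E) {q : LcBlock n Tx} {s : ℕ}
    {j : Fin n} {x : List Tx} (hj : j ∉ corrupt) (t : ℕ) :
    ∀ i ∈ E.awake t, 1 ≤ t → ∀ c, IsCandidate win (E.viewBefore i t) t c →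
      (LcBlock.cons q s j x).IsPrefix c →
      j ∈ E.awake s ∧ 1 ≤ s ∧ s < t ∧ win j s ∧ E.lcTip j s = LcBlock.cons q s j x := by
  induction t using Nat.strong_induction_on with
  | _ t ih =>
    intro i hi ht c hc hp
    have hv := hc.2.1.of_isPrefix hp
    have hst : s < t := (hc.2.1.slot_le hp).trans_lt hc.2.2
    -- An honest node sends only the block it has just made, which carries the current slot; hence
    -- `r = s`.
    have key : ∀ r, Msg.lc (LcBlock.cons q s j x) ∈ E.sent j r →
        j ∈ E.awake s ∧ 1 ≤ s ∧ s < t ∧ win j s ∧ E.lcTip j s = LcBlock.cons q s j x := by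
      intro r hr
      obtain ⟨hjr, hr1⟩ := hE.awake_of_mem_sent hj hr
      obtain ⟨b, hb, hw, -, hm⟩ := hE.lc_rule r hr1 j hjr
      obtain ⟨hwin, he⟩ := (hm _).1 hr
      have he' := hw hwin
      rw [← he] at he'
      injection he' with _ h1
      subst h1
      exact ⟨hjr, hr1, hst, hwin, he.symm⟩
    -- A received chain is covered by authenticity. A chain that `i` sent itself ends in its own
    -- block, and the rest was a candidate of `i` in the earlier slot `s'`, where induction applies.
    rcases hc.1 with rfl | ⟨b', hm | ⟨s', hs', hm⟩, hp'⟩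
    · exact absurd (LcBlock.isPrefix_genesis_iff.1 hp) (by simp)
    · obtain ⟨r, -, hr⟩ := hE.auth_lc i (hE.awake_honest _ _ hi) t b' hm q s j x (hp.trans hp') hj
      exact key r hr
    · obtain ⟨his', hs1⟩ := hE.awake_of_mem_sent (hE.awake_honest _ _ hi) hm
      obtain ⟨b, hb, hw, -, hms⟩ := hE.lc_rule s' hs1 i his'
      obtain ⟨hwin, he⟩ := (hms _).1 hm
      have hpb := hp.trans hp'
      rw [he, hw hwin] at hpb
      rcases LcBlock.isPrefix_cons_iff.1 hpb with h | h
      · have hm' := hm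
        rw [he, hw hwin, ← h] at hm'
        injection h with _ _ h3
        exact key s' (h3 ▸ hm')
      · obtain ⟨h1, h2, h3, h4⟩ := ih s' hs' i his' hs1 b hb.1 h
        exact ⟨h1, h2, hst, h4⟩

open Classical in
/-- Below any block of a valid chain there is a block that is genesis or honest, with only
adversarial blocks in between. -/
lemma exists_honest_ancestor {c : LcBlock n Tx} (hc : c.Valid win) :
    ∃ a : LcBlock n Tx, a.IsPrefix c ∧
      (a = LcBlock.genesis ∨ ∃ q s j x, j ∉ corrupt ∧ a = LcBlock.cons q s j x) ∧
      c.depth ≤ a.depth +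
        ((Finset.Icc (a.slot + 1) c.slot).filter (IsAdvSlot corrupt win)).card := by
  induction c with
  | genesis => exact ⟨LcBlock.genesis, LcBlock.IsPrefix.refl _, Or.inl rfl, by simp⟩
  | cons q s i x ih =>
    by_cases hi : i ∈ corrupt
    · obtain ⟨a, hp, ha, hd⟩ := ih hc.2.2
      refine ⟨a, hp.trans (LcBlock.isPrefix_cons_self ..), ha, ?_⟩
      have hle := hc.2.2.slot_le hp
      have hlt := hc.2.1
      -- Since `q.slot < s`, the slot of the new adversarial block has not been counted before.
      have : insert s ((Finset.Icc (a.slot + 1) q.slot).filter (IsAdvSlot corrupt win)) ⊆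
          (Finset.Icc (a.slot + 1) s).filter (IsAdvSlot corrupt win) := by
        intro y hy
        simp only [Finset.mem_insert, Finset.mem_filter, Finset.mem_Icc] at hy ⊢
        rcases hy with rfl | ⟨⟨h1, h2⟩, h3⟩
        · exact ⟨⟨by omega, le_rfl⟩, i, hi, hc.1⟩
        · exact ⟨⟨h1, by omega⟩, h3⟩
      have hcard := Finset.card_le_card this
      rw [Finset.card_insert_of_notMem (by simp; omega)] at hcard
      simp only [LcBlock.depth, LcBlock.slot] at *
      omega
    · exact ⟨_, LcBlock.IsPrefix.refl _, Or.inr ⟨q, s, i, x, hi, rfl⟩, by simp⟩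

open Classical in
/-- Convergence opportunities push up the depth of the longest chain one by one. -/
lemma card_convergence_le (hE : IsExecution corrupt Δ k win E) (hΔ : 1 ≤ Δ) {a t d : ℕ}
    {j : Fin n} (hj : j ∈ E.awake t) {c : LcBlock n Tx}
    (hc : IsLongest win (E.viewBefore j t) t c) (ha : 1 ≤ a) {b : ℕ} (hb : b + Δ ≤ t)
    (hlow : ∀ u i, a ≤ u → i ∈ E.awake u → win i u →
      IsConvergence corrupt Δ win E u → d < (E.lcTip i u).depth) :
    ((Finset.Icc a b).filter (IsConvergence corrupt Δ win E)).card ≤ c.depth - d := by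
  have hw : ∀ u, IsConvergence corrupt Δ win E u → ∃ i, i ∈ E.awake u ∧ win i u :=
    fun u ⟨i, hi, hu, _⟩ => ⟨i, hi, hu⟩
  -- Depth of the block made in a convergence slot; the value `0` at other slots is never used. The
  -- map is strictly increasing on convergence slots and takes values in `Ioc d c.depth`.
  set f : ℕ → ℕ := fun u =>
    if h : IsConvergence corrupt Δ win E u then (E.lcTip (hw u h).choose u).depth else 0 with hf
  rw [← Nat.card_Ioc]
  refine Finset.card_le_card_of_injOn f ?_ ?_
  · intro u hu
    simp only [Finset.coe_filter, Finset.mem_Icc, Set.mem_ofPred_eq] at hu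
    obtain ⟨h1, h2⟩ := (hw u hu.2).choose_spec
    simp only [hf, dif_pos hu.2, Finset.coe_Ioc, Set.mem_Ioc]
    exact ⟨hlow u _ hu.1.1 h1 h2 hu.2, hE.depth_lcTip_le hΔ h1 (by omega) hj (by omega) hc⟩
  · have key : ∀ u v, u < v → 1 ≤ u → IsConvergence corrupt Δ win E u →
        IsConvergence corrupt Δ win E v → f u < f v := by
      intro u v huv hu1 hu hv
      simp only [hf, dif_pos hu, dif_pos hv]
      obtain ⟨h1, h2⟩ := (hw u hu).choose_spec
      obtain ⟨h3, h4⟩ := (hw v hv).choose_spec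
      refine hE.depth_lcTip_lt hΔ h1 hu1 h3 ?_ h4
      by_contra hlt
      obtain ⟨i, hi, hwi, hun⟩ := hu
      have := (hun _ (hE.awake_honest _ _ h3) v (by omega) (by omega) h4).2
      omega
    intro u hu v hv huv
    simp only [Finset.coe_filter, Finset.mem_Icc, Set.mem_ofPred_eq] at hu hv
    rcases lt_trichotomy u v with h | h | h
    · exact absurd huv (key u v h (by omega) hu.2 hv.2).ne
    · exact h
    · exact absurd huv (key v u h (by omega) hv.2 hu.2).ne'

open Classical in
/-- The block of a pivot stays on all longest chains. -/
theorem isPrefix_of_isPivot (hE : IsExecution corrupt Δ k win E) (hΔ : 1 ≤ Δ) {H s : ℕ}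
    (hs : IsPivot corrupt Δ H win E s) :
    ∃ B : LcBlock n Tx, B.slot = s ∧ ∀ t, s + Δ ≤ t → t ≤ H → ∀ j ∈ E.awake t,
      B.IsPrefix (E.lcTip j t) := by
  obtain ⟨hs1, ⟨i, hi, hwi, hun⟩, hcount⟩ := hs
  have hconv : IsConvergence corrupt Δ win E s := ⟨i, hi, hwi, hun⟩
  obtain ⟨bi, hbi, hti, -⟩ := hE.lc_rule s hs1 i hi
  refine ⟨E.lcTip i s, by rw [hti hwi]; rfl, fun t => ?_⟩
  -- Induction is needed for honest blocks made at least `Δ` slots after `s`: their makers already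
  -- built on the block of the pivot.
  induction t using Nat.strong_induction_on with
  | _ t ih =>
    intro hst htH j hj
    obtain ⟨c, hc, hcp, -⟩ := hE.exists_base hj (by omega)
    refine LcBlock.IsPrefix.trans ?_ hcp
    obtain ⟨a, hac, ha, hd⟩ := exists_honest_ancestor (corrupt := corrupt) hc.1.2.1
    have hcslot := hc.1.2.2
    have hcand := hc.1.of_isPrefix hac
    by_contra hnot
    -- An honest `a` made at or after `s` would contain the pivot block: by induction if far from
    -- `s`, by isolation of `s` if near. Later convergence slots are isolated from the slot of `a`
    -- too, so their blocks are deeper than `a`.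
    have hgood : a.slot < s ∧ ∀ u i', a.slot + 1 ≤ u → i' ∈ E.awake u → win i' u →
        IsConvergence corrupt Δ win E u → a.depth < (E.lcTip i' u).depth := by
      rcases ha with rfl | ⟨q, r, j', x, hj', rfl⟩
      · refine ⟨hs1, fun u i' hu hi' hw _ => ?_⟩
        obtain ⟨b, hb, htip, -⟩ := hE.lc_rule u (by omega) i' hi'
        rw [htip hw]
        simp [LcBlock.depth]
      · obtain ⟨hjr, hr1, hrt, hwr, htip⟩ :=
          hE.eq_lcTip_of_isPrefix hj' t j hj (by omega) c hc.1 hac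
        simp only [LcBlock.slot] at *
        have hrs : r < s := by
          by_contra hge
          by_cases hfar : s + Δ ≤ r
          · have := ih r hrt hfar (by omega) j' hjr
            rw [htip] at this
            exact hnot (this.trans hac)
          · obtain ⟨rfl, rfl⟩ := hun j' hj' r (by omega) (by omega) hwr
            rw [← htip] at hac
            exact hnot hac
        refine ⟨hrs, fun u i' hu hi' hw ⟨i'', _, _, hun'⟩ => ?_⟩
        rw [← htip]
        refine hE.depth_lcTip_lt hΔ hjr hr1 hi' ?_ hw
        by_contra hlt
        have := (hun' j' hj' r (by omega) (by omega) hwr).2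
        omega
    have h1 := hE.card_convergence_le hΔ hj hc (a := a.slot + 1) (by omega) (b := t - Δ)
      (by omega) hgood.2
    -- The interval stops at `t - Δ`, since later blocks need not be known at time `t`; the `Δ`
    -- extra slots that a pivot grants the adversary make up for this.
    have h2 := hcount (a.slot + 1) (t - Δ) (by omega) hgood.1 (by omega) (by omega)
    have h3 : ((Finset.Icc (a.slot + 1) c.slot).filter (IsAdvSlot corrupt win)).card ≤
        ((Finset.Icc (a.slot + 1) (t - Δ + Δ)).filter (IsAdvSlot corrupt win)).card :=
      Finset.card_le_card (Finset.filter_subset_filter _ (Finset.Icc_subset_Icc_right (by omega)))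
    omega

/-- Safety of the longest-chain protocol, provided that every window of `k` slots has a pivot. -/
theorem confirmed_isPrefix (hE : IsExecution corrupt Δ k win E) (hΔ : 1 ≤ Δ) {H : ℕ}
    (hpiv : ∀ t, k ≤ t → t ≤ H → ∃ s, t < s + k ∧ s + Δ ≤ t ∧ IsPivot corrupt Δ H win E s)
    {i j : Fin n} {t t' : ℕ} (hi : i ∈ E.awake t) (ht : 1 ≤ t) (hj : j ∈ E.awake t')
    (htt' : t ≤ t') (ht' : t' ≤ H) :
    (E.confirmed k i t).IsPrefix (E.lcTip j t') := by
  obtain ⟨-, -, -, hv, hslot⟩ := hE.exists_base hi ht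
  have hgen : E.confirmed k i t = LcBlock.genesis →
      (E.confirmed k i t).IsPrefix (E.lcTip j t') := fun h => h ▸ LcBlock.genesis_isPrefix _
  rcases hv.truncate_slot k with h | h
  · exact hgen h
  -- The truncated chain ends at slot at most `t - k`, before the pivot, so it is a prefix of the
  -- pivot block, which lies on both longest chains.
  · obtain ⟨s, h1, h2, hs⟩ := hpiv t (by omega) (by omega)
    obtain ⟨B, rfl, hB⟩ := hE.isPrefix_of_isPivot hΔ hs
    refine LcBlock.IsPrefix.trans ?_ (hB t' (by omega) ht' j hj)
    exact hv.isPrefix_of_slot_lt (LcBlock.truncate_isPrefix _ _) (hB t h2 (by omega) i hi)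
      (by change (LcBlock.truncate k _).slot < _; omega)

end IsExecution

/-! ### Chains of BFT blocks -/

variable {n : ℕ} {Tx : Type u}

namespace BftBlock

lemma exists_chain_eq_append (b : BftBlock n Tx) : ∃ l, b.chain = l ++ [b] := by
  cases b with
  | genesis => exact ⟨[], rfl⟩
  | cons q e b => exact ⟨q.chain, rfl⟩

lemma chain_injective : Function.Injective (chain : BftBlock n Tx → List (BftBlock n Tx)) := by
  intro a b h
  obtain ⟨l, hl⟩ := exists_chain_eq_append a
  obtain ⟨l', hl'⟩ := exists_chain_eq_append b
  rw [hl, hl'] at h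
  simpa using (List.append_inj' h rfl).2

lemma isPrefix_cons_iff {a q : BftBlock n Tx} {e : ℕ} {b : LcBlock n Tx} :
    a.IsPrefix (cons q e b) ↔ a = cons q e b ∨ a.IsPrefix q := by
  unfold IsPrefix
  rw [show (cons q e b).chain = q.chain ++ [cons q e b] from rfl, List.prefix_concat_iff]
  exact or_congr ⟨fun h => chain_injective h, fun h => by rw [h]; rfl⟩ Iff.rfl

lemma IsPrefix.trans {a b c : BftBlock n Tx} (h : a.IsPrefix b) (h' : b.IsPrefix c) :
    a.IsPrefix c := List.IsPrefix.trans h h'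

lemma isPrefix_genesis {a : BftBlock n Tx} (h : a.IsPrefix genesis) : a = genesis := by
  cases a with
  | genesis => rfl
  | cons q e b =>
    have := h.length_le
    obtain ⟨l, hl⟩ := exists_chain_eq_append q
    simp [chain, hl] at this

lemma exists_of_mem_snapshots {B : BftBlock n Tx} {b : LcBlock n Tx} (h : b ∈ B.snapshots) :
    ∃ q e, (cons q e b).IsPrefix B := by
  induction B with
  | genesis => simp [snapshots] at h
  | cons q e b' ih =>
    simp only [snapshots, List.mem_append, List.mem_singleton] at h
    rcases h with h | rfl
    · obtain ⟨q', e', h'⟩ := ih h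
      exact ⟨q', e', isPrefix_cons_iff.2 (Or.inr h')⟩
    · exact ⟨q, e, isPrefix_cons_iff.2 (Or.inl rfl)⟩

end BftBlock

lemma NotarizedChain.notarized {V : Set (Msg n Tx)} {B : BftBlock n Tx} (h : NotarizedChain V B)
    {q : BftBlock n Tx} {e : ℕ} {b : LcBlock n Tx} (hp : (BftBlock.cons q e b).IsPrefix B) :
    Notarized V (BftBlock.cons q e b) ∧ e ≤ B.epoch := by
  induction B with
  | genesis => exact absurd (BftBlock.isPrefix_genesis hp) (by simp)
  | cons q' e' b' ih =>
    rcases BftBlock.isPrefix_cons_iff.1 hp with h' | h'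
    · rw [h']; injection h' with _ h2; exact ⟨h.1, h2.le⟩
    · obtain ⟨h1, h2⟩ := ih h.2.2 h'
      exact ⟨h1, h2.trans h.2.1.le⟩

/-! ### Sanitizing concatenated chains -/

section Sanitize

variable {α : Type*}

open Classical in
lemma foldl_insert_of_subset (l acc : List α) (h : ∀ a ∈ l, a ∈ acc) :
    l.foldl (fun acc a => if a ∈ acc then acc else acc ++ [a]) acc = acc := by
  induction l with
  | nil => rfl
  | cons a l ih =>
    rw [List.foldl_cons, if_pos (h a (by simp))]
    exact ih fun b hb => h b (by simp [hb])

open Classical in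
lemma foldl_insert_of_nodup (l acc : List α) (h : (acc ++ l).Nodup) :
    l.foldl (fun acc a => if a ∈ acc then acc else acc ++ [a]) acc = acc ++ l := by
  induction l generalizing acc with
  | nil => simp
  | cons a l ih =>
    have ha : a ∉ acc := fun ha => (List.nodup_append.1 h).2.2 a ha a (by simp) rfl
    rw [List.foldl_cons, if_neg ha, ih _ (by simpa using h)]
    simp

/-- Sanitizing a concatenation of prefixes of a list without duplicates yields one of them. -/
lemma sanitize_flatMap {β : Type*} (f : β → List α) (l : List β) (x : List α) (hx : x.Nodup)
    (h : ∀ b ∈ l, f b <+: x) :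
    Execution.sanitize (l.flatMap f) <+: x := by
  induction l using List.reverseRecOn with
  | nil => simp [Execution.sanitize]
  | append_singleton l b ih =>
    have ih' := ih fun b hb => h b (by simp [hb])
    have hb := h b (by simp)
    unfold Execution.sanitize at *
    rw [List.flatMap_append, List.foldl_append, List.flatMap_singleton]
    -- The next list is either contained in the accumulated one and adds nothing, or extends it, and
    -- then exactly the missing tail is appended.
    rcases List.prefix_or_prefix_of_prefix hb ih' with h1 | h1
    · rw [foldl_insert_of_subset _ _ fun a ha => h1.subset ha]
      exact ih'
    · obtain ⟨r, hr⟩ := h1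
      rw [← hr, List.foldl_append, foldl_insert_of_subset _ _ fun a ha => ha,
        foldl_insert_of_nodup, hr]
      · exact hb
      · rw [hr]; exact hx.sublist hb.sublist

end Sanitize

/-! ### Votes, finality and the deterministic theorem -/

lemma slot_eq_of_isVoteSlot {Δ r : ℕ} (hr : 1 ≤ r) (h : IsVoteSlot Δ r) :
    r + 2 * Δ = 2 * Δ * epochOf Δ r + Δ + 1 := by
  have := Nat.div_add_mod (r - 1) (2 * Δ)
  unfold IsVoteSlot at h
  unfold epochOf
  rw [Nat.mul_add]
  omega

/-- Already slot `1` gives it: the adversarial nodes number at most `β` times the awake nodes, hence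
at most `β * n`. This is all that the quorum argument needs, so no bound of one third is involved.
-/
lemma HonestParticipation.two_mul_card_lt {corrupt : Finset (Fin n)} {β : ℝ}
    {E : Execution n Tx} (h : HonestParticipation corrupt β E) (hβ₀ : 0 ≤ β) (hβ : β < 1 / 2)
    (hE : ∀ t, ∀ i ∈ E.awake t, i ∉ corrupt) : 2 * corrupt.card < n := by
  obtain ⟨⟨i, hi⟩, hc⟩ := h 1 le_rfl
  have hdisj : Disjoint corrupt (E.awake 1) :=
    Finset.disjoint_left.2 fun j hj hj' => hE 1 j hj' hj
  have hcard : corrupt.card + (E.awake 1).card ≤ n := by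
    rw [← Finset.card_union_of_disjoint hdisj]
    simpa using Finset.card_le_univ (corrupt ∪ E.awake 1)
  have hpos : 0 < n := i.pos
  have h1 : (corrupt.card : ℝ) + ((E.awake 1).card : ℝ) ≤ n := by exact_mod_cast hcard
  have h2 : (0 : ℝ) < n := by exact_mod_cast hpos
  have : (2 * corrupt.card : ℝ) < n := by nlinarith
  exact_mod_cast this

namespace IsExecution

variable {corrupt : Finset (Fin n)} {Δ k : ℕ} {win : Fin n → ℕ → Prop} {E : Execution n Tx}

/-- A notarized block got the vote of an honest node, which saw the snapshot as confirmed. -/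
lemma exists_vote (hE : IsExecution corrupt Δ k win E) (hf : 2 * corrupt.card < n)
    {i : Fin n} {t : ℕ} (hi : i ∈ E.awake t) {q : BftBlock n Tx} {e : ℕ} {b : LcBlock n Tx}
    (h : Notarized (E.view i t) (BftBlock.cons q e b)) :
    ∃ j r, j ∈ E.awake r ∧ 1 ≤ r ∧ r ≤ t ∧ r + 2 * Δ = 2 * Δ * e + Δ + 1 ∧
      b.IsPrefix (E.confirmed k j r) := by
  obtain ⟨j, hjc, hj⟩ : ∃ j, j ∉ corrupt ∧ Msg.vote (BftBlock.cons q e b) j ∈ E.view i t := by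
    -- With adversarial votes only, `2 * n ≤ 3 * corrupt.card`, against `2 * corrupt.card < n`.
    by_contra! hno
    have hsub : {j : Fin n | Msg.vote (BftBlock.cons q e b) j ∈ E.view i t} ⊆ corrupt := by
      intro j hj
      by_contra hjc
      exact hno j hjc hj
    have := Set.ncard_le_ncard hsub (Finset.finite_toSet _)
    rw [Set.ncard_coe_finset] at this
    unfold Notarized at h
    omega
  have key : ∀ j' r, r ≤ t → j' ∉ corrupt → Msg.vote (BftBlock.cons q e b) j ∈ E.sent j' r →
      ∃ j r, j ∈ E.awake r ∧ 1 ≤ r ∧ r ≤ t ∧ r + 2 * Δ = 2 * Δ * e + Δ + 1 ∧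
        b.IsPrefix (E.confirmed k j r) := by
    intro j' r hrt hj' hr
    obtain ⟨hjr, hr1⟩ := hE.awake_of_mem_sent hj' hr
    obtain ⟨hv, hnv⟩ := hE.vote_rule r hr1 j' hjr
    by_cases hcase : IsVoteSlot Δ r ∧ ∃ q b, E.ValidProposal Δ j' r q b
    · obtain ⟨q', b', -, hm⟩ := hv hcase
      obtain ⟨-, h2, h3⟩ := (hm _ _).1 hr
      injection h2 with _ h4 h5
      refine ⟨j', r, hjr, hr1, hrt, ?_, h5 ▸ h3⟩
      rw [h4]
      exact slot_eq_of_isVoteSlot hr1 hcase.1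
    · exact absurd hr (hnv hcase _ _)
  rcases hj with hj | ⟨r, hr, hj⟩
  · obtain ⟨r, hr, hj⟩ := hE.auth_vote i (hE.awake_honest _ _ hi) t _ _ hj hjc
    exact key j r hr.le hjc hj
  · exact key i r hr (hE.awake_honest _ _ hi) hj

/-- Sleeping nodes keep their state, so claims about all honest nodes reduce to awake ones, at an
earlier slot. -/
lemma exists_last_awake (hE : IsExecution corrupt Δ k win E) {i : Fin n} (hi : i ∉ corrupt)
    (t : ℕ) : (E.lcTip i t = LcBlock.genesis ∧ E.bftTip i t = BftBlock.genesis) ∨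
      ∃ s ≤ t, 1 ≤ s ∧ i ∈ E.awake s ∧ E.lcTip i t = E.lcTip i s ∧ E.bftTip i t = E.bftTip i s := by
  induction t with
  | zero => exact Or.inl (hE.init i hi).2.2
  | succ t ih =>
    by_cases h : i ∈ E.awake (t + 1)
    · exact Or.inr ⟨t + 1, le_rfl, by omega, h, rfl, rfl⟩
    · obtain ⟨-, -, h1, h2⟩ := hE.asleep i hi t h
      rw [h1, h2]
      exact ih.imp_right fun ⟨s, hs, h⟩ => ⟨s, hs.trans (Nat.le_succ _), h⟩

/-- If every window of `k` slots up to the horizon has a pivot, then the finalized ledgers are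
safe prefixes of the longest-chain ledgers. -/
theorem finIsSafePrefix (hE : IsExecution corrupt Δ k win E) (hΔ : 1 ≤ Δ)
    (hf : 2 * corrupt.card < n) {H : ℕ}
    (hpiv : ∀ t, k ≤ t → t ≤ H → ∃ s, t < s + k ∧ s + Δ ≤ t ∧ IsPivot corrupt Δ H win E s) :
    FinIsSafePrefix corrupt k H E := by
  have hpre : ∀ i, i ∉ corrupt → ∀ t ≤ H, E.logFin i t <+: E.chLc k i t := by
    intro i hi t ht
    refine sanitize_flatMap _ _ _ (LcBlock.chain_nodup _) fun b hb => ?_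
    rcases hE.exists_last_awake hi t with ⟨-, h⟩ | ⟨t₀, ht₀, h1, hit, hlc, hbft⟩
    · rw [h] at hb; simp [BftBlock.snapshots] at hb
    change b.IsPrefix ((E.lcTip i t).truncate k)
    rw [hlc]
    rw [hbft] at hb
    obtain ⟨q, e, hp⟩ := BftBlock.exists_of_mem_snapshots hb
    rcases hE.final_rule t₀ h1 i hit with hfin | ⟨B₀, b₁, b₂, hnot, hBp⟩
    · rw [hfin] at hp; exact absurd (BftBlock.isPrefix_genesis hp) (by simp)
    obtain ⟨hn1, he⟩ := hnot.2.2.notarized (hp.trans hBp)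
    obtain ⟨j, r, hjr, hr1, hrt, hre, hbp⟩ := hE.exists_vote hf hit hn1
    obtain ⟨j₂, r₂, -, -, hrt₂, hre₂, -⟩ := hE.exists_vote hf hit hnot.1
    -- This is where finality enters: the third block is from a later epoch than the block with the
    -- snapshot, so the honest vote for it comes at least `2 * Δ` slots after `r`, and `t₀` is later
    -- still.
    have hrr : r + 2 * Δ ≤ r₂ := by
      have h3 : 2 * Δ * (e + 1) ≤ 2 * Δ * (B₀.epoch + 2) :=
        Nat.mul_le_mul_left _ (by change e ≤ B₀.epoch + 1 at he; omega)
      rw [Nat.mul_add] at h3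
      omega
    have hsafe := hE.confirmed_isPrefix hΔ hpiv hjr hr1 hit (by omega) (by omega)
    -- Both confirmed chains are prefixes of the longest chain of `i`, so comparing depths is
    -- enough; the tip of `j` has reached `i` by `t₀`, hence `i` has at least the same depth.
    refine hbp.trans (LcBlock.isPrefix_of_depth_le hsafe (LcBlock.truncate_isPrefix _ _) ?_)
    obtain ⟨c, hc, hcp, -⟩ := hE.exists_base hit h1
    have := (hE.depth_lcTip_le hΔ hjr hr1 hit (by omega) hc).trans hcp.depth_le
    unfold Execution.confirmed
    rw [LcBlock.depth_truncate, LcBlock.depth_truncate]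
    omega
  have hcomp : ∀ i j, i ∉ corrupt → j ∉ corrupt → ∀ t ≤ H, ∀ t' ≤ H,
      E.chLc k i t <+: E.chLc k j t' ∨ E.chLc k j t' <+: E.chLc k i t := by
    intro i j hi hj t ht t' ht'
    change LcBlock.IsPrefix ((E.lcTip i t).truncate k) ((E.lcTip j t').truncate k) ∨
      LcBlock.IsPrefix ((E.lcTip j t').truncate k) ((E.lcTip i t).truncate k)
    rcases hE.exists_last_awake hi t with ⟨h, -⟩ | ⟨s, hs, h1, his, hlc, -⟩
    · left; rw [h, LcBlock.truncate_genesis]; exact LcBlock.genesis_isPrefix _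
    rcases hE.exists_last_awake hj t' with ⟨h, -⟩ | ⟨s', hs', h1', hjs, hlc', -⟩
    · right; rw [h, LcBlock.truncate_genesis]; exact LcBlock.genesis_isPrefix _
    rw [hlc, hlc']
    rcases le_total s s' with h | h
    · exact LcBlock.isPrefix_total
        (hE.confirmed_isPrefix hΔ hpiv his h1 hjs h (by omega)) (LcBlock.truncate_isPrefix _ _)
    · exact LcBlock.isPrefix_total (LcBlock.truncate_isPrefix _ _)
        (hE.confirmed_isPrefix hΔ hpiv hjs h1' his h (by omega))
  have hcons : ∀ i j, i ∉ corrupt → j ∉ corrupt → ∀ t ≤ H, ∀ t' ≤ H,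
      E.logFin i t <+: E.chLc k j t' ∨ E.chLc k j t' <+: E.logFin i t := by
    intro i j hi hj t ht t' ht'
    rcases hcomp i j hi hj t ht t' ht' with h | h
    · exact Or.inl ((hpre i hi t ht).trans h)
    · exact List.prefix_or_prefix_of_prefix (hpre i hi t ht) h
  refine ⟨hpre, hcons, fun i j hi hj t ht t' ht' => ?_⟩
  rcases hcons i j hi hj t ht t' ht' with h | h
  · exact List.prefix_or_prefix_of_prefix h (hpre j hj t' ht')
  · exact Or.inr ((hpre j hj t' ht').trans h)

end IsExecution

/-! ### From block counts to pivots -/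

/-- For block counts `c` of convergence opportunities and `a` of adversarial slots: the block `m₀`
has a convergence opportunity and no adversarial slot, and on both sides convergence opportunities
keep up with adversarial slots, up to the horizon `K`. -/
structure IsBlockPivot (c a : ℕ → ℕ) (K m₀ : ℕ) : Prop where
  adv_eq_zero : a m₀ = 0
  one_le_conv : 1 ≤ c m₀
  right : ∀ m, m₀ ≤ m → m ≤ K →
    ∑ j ∈ Finset.Ioc m₀ (m + 1), a j ≤ ∑ j ∈ Finset.Ioo m₀ m, c j
  left : ∀ m ≤ m₀, ∑ j ∈ Finset.Ico m m₀, a j ≤ ∑ j ∈ Finset.Ioo m m₀, c j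

lemma pred_div_eq_iff {B u m : ℕ} (hu : 1 ≤ u) (hB : 1 ≤ B) :
    (u - 1) / B = m ↔ m * B < u ∧ u ≤ (m + 1) * B := by
  rw [Nat.div_eq_iff hB, Nat.add_mul]
  omega

open Classical in
-- An interval may cut its two end blocks: these count fully for the adversary and not at all for
-- convergence, and as `Δ ≤ B` the `Δ` extra slots reach at most one further block. This explains
-- the ranges in `IsBlockPivot`. Strictness comes from the convergence slot in block `m₀`.
lemma IsBlockPivot.exists_isPivot {n : ℕ} {Tx : Type u} {corrupt : Finset (Fin n)} {Δ : ℕ}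
    {win : Fin n → ℕ → Prop} {E : Execution n Tx} {B H m₀ : ℕ} {c a : ℕ → ℕ}
    (h : IsBlockPivot c a H m₀) (hB : 1 ≤ B) (hΔB : Δ ≤ B)
    (hc : ∀ m, c m ≤ ((Finset.Ioc (m * B) ((m + 1) * B)).filter
      (IsConvergence corrupt Δ win E)).card)
    (ha : ∀ m, ((Finset.Ioc (m * B) ((m + 1) * B)).filter
      (IsAdvSlot corrupt win)).card ≤ a m) :
    ∃ s, m₀ * B < s ∧ s ≤ (m₀ + 1) * B ∧ IsPivot corrupt Δ H win E s := by
  obtain ⟨s, hs⟩ := Finset.card_pos.1 (h.one_le_conv.trans (hc m₀))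
  rw [Finset.mem_filter, Finset.mem_Ioc] at hs
  refine ⟨s, hs.1.1, hs.1.2, by omega, hs.2, fun x y hx hxs hsy hyH => ?_⟩
  set mx := (x - 1) / B with hmx
  set my := (y - 1) / B with hmy
  have hs0 : (s - 1) / B = m₀ := (pred_div_eq_iff (by omega) hB).2 hs.1
  have h1 : mx ≤ m₀ := hs0 ▸ Nat.div_le_div_right (by omega)
  have h2 : m₀ ≤ my := hs0 ▸ Nat.div_le_div_right (by omega)
  -- A block index never exceeds its slot numbers, so the horizon in slots also serves as horizon in
  -- blocks.
  have h3 : my ≤ H := (Nat.div_le_self _ _).trans (by omega)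
  obtain ⟨hx1, hx2⟩ := (pred_div_eq_iff (by omega) hB).1 hmx.symm
  obtain ⟨hy1, hy2⟩ := (pred_div_eq_iff (by omega) hB).1 hmy.symm
  have hadv : ((Finset.Icc x (y + Δ)).filter (IsAdvSlot corrupt win)).card ≤
      ∑ m ∈ Finset.Icc mx (my + 1), a m := by
    rw [Finset.card_eq_sum_card_fiberwise (f := fun u => (u - 1) / B) (t := Finset.Icc mx (my + 1))]
    · refine Finset.sum_le_sum fun m _ => (Finset.card_le_card ?_).trans (ha m)
      intro u hu
      simp only [Finset.mem_filter, Finset.mem_Icc, Finset.mem_Ioc] at hu ⊢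
      exact ⟨(pred_div_eq_iff (by omega) hB).1 hu.2, hu.1.2⟩
    · intro u hu
      simp only [Finset.coe_filter, Finset.mem_Icc, Set.mem_ofPred_eq, Finset.coe_Icc,
        Set.mem_Icc] at hu ⊢
      refine ⟨Nat.div_le_div_right (by omega), ?_⟩
      rw [← Nat.lt_succ_iff, Nat.div_lt_iff_lt_mul hB]
      have : (my + 1).succ * B = (my + 1) * B + B := by rw [Nat.succ_mul]
      omega
  have hcon : ∑ m ∈ Finset.Ioo mx m₀, c m + (1 + ∑ m ∈ Finset.Ioo m₀ my, c m) ≤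
      ((Finset.Icc x y).filter (IsConvergence corrupt Δ win E)).card := by
    rw [Finset.card_eq_sum_card_fiberwise (f := fun u => (u - 1) / B) (t := Finset.Icc mx my)]
    · have hfib : ∀ m, mx < m → m < my → c m ≤
          (((Finset.Icc x y).filter (IsConvergence corrupt Δ win E)).filter
            fun u => (u - 1) / B = m).card := by
        intro m hm1 hm2
        refine (hc m).trans (Finset.card_le_card ?_)
        intro u hu
        simp only [Finset.mem_filter, Finset.mem_Icc, Finset.mem_Ioc] at hu ⊢
        have e1 : (mx + 1) * B ≤ m * B := Nat.mul_le_mul_right _ hm1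
        have e2 : (m + 1) * B ≤ my * B := Nat.mul_le_mul_right _ hm2
        exact ⟨⟨by omega, hu.2⟩, (pred_div_eq_iff (by omega) hB).2 hu.1⟩
      have hmid : 1 ≤ (((Finset.Icc x y).filter (IsConvergence corrupt Δ win E)).filter
            fun u => (u - 1) / B = m₀).card :=
        Finset.card_pos.2 ⟨s, by simp only [Finset.mem_filter, Finset.mem_Icc]; tauto⟩
      -- The union is just `Finset.Icc mx my`, written so that the three disjoint pieces are visibly
      -- contained in it.
      rw [← Finset.sum_subset (s₁ := insert m₀ (Finset.Ioo mx m₀ ∪ Finset.Ioo m₀ my)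
          ∪ Finset.Icc mx my) (s₂ := Finset.Icc mx my)]
      · have hsub : insert m₀ (Finset.Ioo mx m₀ ∪ Finset.Ioo m₀ my) ⊆
            insert m₀ (Finset.Ioo mx m₀ ∪ Finset.Ioo m₀ my) ∪ Finset.Icc mx my :=
          Finset.subset_union_left
        refine le_trans ?_ (Finset.sum_le_sum_of_subset hsub)
        rw [Finset.sum_insert (by simp), Finset.sum_union]
        · have g1 := Finset.sum_le_sum (s := Finset.Ioo mx m₀) fun m hm =>
            hfib m (Finset.mem_Ioo.1 hm).1 ((Finset.mem_Ioo.1 hm).2.trans_le h2)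
          have g2 := Finset.sum_le_sum (s := Finset.Ioo m₀ my) fun m hm =>
            hfib m (h1.trans_lt (Finset.mem_Ioo.1 hm).1) (Finset.mem_Ioo.1 hm).2
          omega
        · refine Finset.disjoint_left.2 fun m hm hm' => ?_
          rw [Finset.mem_Ioo] at hm hm'
          omega
      · intro m hm
        simp only [Finset.mem_union, Finset.mem_insert, Finset.mem_Ioo, Finset.mem_Icc] at hm ⊢
        omega
      · intro m hm hm'
        exact absurd (Finset.mem_union_right _ hm) hm'
    · intro u hu
      simp only [Finset.coe_filter, Finset.mem_Icc, Set.mem_ofPred_eq, Finset.coe_Icc,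
        Set.mem_Icc] at hu ⊢
      exact ⟨Nat.div_le_div_right (by omega), Nat.div_le_div_right (by omega)⟩
  have hsplit : ∑ m ∈ Finset.Icc mx (my + 1), a m ≤
      ∑ m ∈ Finset.Ico mx m₀, a m + ∑ m ∈ Finset.Ioc m₀ (my + 1), a m := by
    have hsub : Finset.Icc mx (my + 1) ⊆
        insert m₀ (Finset.Ico mx m₀ ∪ Finset.Ioc m₀ (my + 1)) := by
      intro m hm
      simp only [Finset.mem_union, Finset.mem_insert, Finset.mem_Ico, Finset.mem_Ioc,
        Finset.mem_Icc] at hm ⊢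
      omega
    refine (Finset.sum_le_sum_of_subset hsub).trans ?_
    rw [Finset.sum_insert (by simp), h.adv_eq_zero, zero_add, Finset.sum_union]
    refine Finset.disjoint_left.2 fun m hm hm' => ?_
    rw [Finset.mem_Ico] at hm
    rw [Finset.mem_Ioc] at hm'
    omega
  have := h.right my h2 h3
  have := h.left mx h1
  omega

/-- Sufficient conditions for a block pivot in terms of the excess of convergence opportunities over
adversarial slots: `M` perfect blocks on each side, and then no large deficit. -/
lemma isBlockPivot_of_tails {c a : ℕ → ℕ} {B M K m₀ : ℕ} (hM : 2 * B + 1 ≤ M) (hMm : M ≤ m₀)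
    (haB : ∀ m, a m ≤ B)
    (hmid : ∀ m, m₀ ≤ m + M → m ≤ m₀ + M → a m = 0 ∧ 1 ≤ c m)
    (hright : ∀ m, m₀ + M < m → m ≤ K →
      (∑ j ∈ Finset.Ioo (m₀ + M) m, a j : ℕ) ≤ ∑ j ∈ Finset.Ioo (m₀ + M) m, c j + (M - 2 * B))
    (hleft : ∀ m, m + M < m₀ →
      (∑ j ∈ Finset.Ioo m (m₀ - M), a j : ℕ) ≤ ∑ j ∈ Finset.Ioo m (m₀ - M), c j + (M - 2 * B)) :
    IsBlockPivot c a K m₀ := by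
  refine ⟨(hmid m₀ (by omega) (by omega)).1, (hmid m₀ (by omega) (by omega)).2, ?_, ?_⟩
  · intro m h1 h2
    rcases lt_or_ge (m₀ + M) m with h | h
    · have e1 : ∑ j ∈ Finset.Ioc m₀ (m + 1), a j ≤ ∑ j ∈ Finset.Ioo (m₀ + M) m, a j + 2 * B := by
        have hsub : Finset.Ioc m₀ (m + 1) ⊆
            Finset.Ioc m₀ (m₀ + M) ∪ (Finset.Ioo (m₀ + M) m ∪ {m, m + 1}) := by
          intro j
          simp only [Finset.mem_union, Finset.mem_insert, Finset.mem_singleton, Finset.mem_Ioo,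
            Finset.mem_Ioc]
          omega
        refine (Finset.sum_le_sum_of_subset hsub).trans ?_
        rw [Finset.sum_union, Finset.sum_union, Finset.sum_eq_zero, Finset.sum_pair (by omega)]
        · have := haB m
          have := haB (m + 1)
          omega
        · intro j hj
          rw [Finset.mem_Ioc] at hj
          exact (hmid j (by omega) (by omega)).1
        · simp
        · refine Finset.disjoint_left.2 fun j hj => ?_
          simp only [Finset.mem_union, Finset.mem_insert, Finset.mem_singleton, Finset.mem_Ioo,
            Finset.mem_Ioc] at hj ⊢
          omega
      have e2 : M + ∑ j ∈ Finset.Ioo (m₀ + M) m, c j ≤ ∑ j ∈ Finset.Ioo m₀ m, c j := by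
        have hsub : Finset.Ioc m₀ (m₀ + M) ∪ Finset.Ioo (m₀ + M) m ⊆ Finset.Ioo m₀ m := by
          intro j
          simp only [Finset.mem_union, Finset.mem_Ioo, Finset.mem_Ioc]
          omega
        refine le_trans ?_ (Finset.sum_le_sum_of_subset hsub)
        rw [Finset.sum_union]
        · refine Nat.add_le_add_right ?_ _
          have := Finset.card_nsmul_le_sum (Finset.Ioc m₀ (m₀ + M)) c 1 fun j hj => by
            rw [Finset.mem_Ioc] at hj
            exact (hmid j (by omega) (by omega)).2
          simpa using this
        · refine Finset.disjoint_left.2 fun j hj => ?_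
          simp only [Finset.mem_Ioo, Finset.mem_Ioc] at hj ⊢
          omega
      have := hright m h h2
      omega
    · rcases lt_or_ge (m + 1) (m₀ + M + 1) with h' | h'
      · rw [Finset.sum_eq_zero]
        · omega
        · intro j hj
          rw [Finset.mem_Ioc] at hj
          exact (hmid j (by omega) (by omega)).1
      · obtain rfl : m = m₀ + M := by omega
        rw [Finset.sum_Ioc_succ_top (by omega), Finset.sum_eq_zero]
        · have : (Finset.Ioo m₀ (m₀ + M)).card • 1 ≤ ∑ j ∈ Finset.Ioo m₀ (m₀ + M), c j :=
            Finset.card_nsmul_le_sum _ _ _ fun j hj => by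
            rw [Finset.mem_Ioo] at hj
            exact (hmid j (by omega) (by omega)).2
          simp only [Nat.card_Ioo, smul_eq_mul, mul_one] at this
          have := haB (m₀ + M + 1)
          omega
        · intro j hj
          rw [Finset.mem_Ioc] at hj
          exact (hmid j (by omega) (by omega)).1
  · intro m hm
    rcases lt_or_ge (m + M) m₀ with h | h
    · have e1 : ∑ j ∈ Finset.Ico m m₀, a j ≤ ∑ j ∈ Finset.Ioo m (m₀ - M), a j + B := by
        have hsub : Finset.Ico m m₀ ⊆
            Finset.Ico (m₀ - M) m₀ ∪ (Finset.Ioo m (m₀ - M) ∪ {m}) := by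
          intro j
          simp only [Finset.mem_union, Finset.mem_singleton, Finset.mem_Ioo, Finset.mem_Ico]
          omega
        refine (Finset.sum_le_sum_of_subset hsub).trans ?_
        rw [Finset.sum_union, Finset.sum_union, Finset.sum_eq_zero, Finset.sum_singleton]
        · have := haB m
          omega
        · intro j hj
          rw [Finset.mem_Ico] at hj
          exact (hmid j (by omega) (by omega)).1
        · simp
        · refine Finset.disjoint_left.2 fun j hj => ?_
          simp only [Finset.mem_union, Finset.mem_singleton, Finset.mem_Ioo, Finset.mem_Ico] at hj ⊢
          omega
      have e2 : M + ∑ j ∈ Finset.Ioo m (m₀ - M), c j ≤ ∑ j ∈ Finset.Ioo m m₀, c j := by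
        have hsub : Finset.Ico (m₀ - M) m₀ ∪ Finset.Ioo m (m₀ - M) ⊆ Finset.Ioo m m₀ := by
          intro j
          simp only [Finset.mem_union, Finset.mem_Ioo, Finset.mem_Ico]
          omega
        refine le_trans ?_ (Finset.sum_le_sum_of_subset hsub)
        rw [Finset.sum_union]
        · refine Nat.add_le_add_right ?_ _
          have : (Finset.Ico (m₀ - M) m₀).card • 1 ≤ ∑ j ∈ Finset.Ico (m₀ - M) m₀, c j :=
            Finset.card_nsmul_le_sum _ _ _ fun j hj => by
            rw [Finset.mem_Ico] at hj
            exact (hmid j (by omega) (by omega)).2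
          simp only [Nat.card_Ico, smul_eq_mul, mul_one] at this
          omega
        · refine Finset.disjoint_left.2 fun j hj => ?_
          simp only [Finset.mem_Ioo, Finset.mem_Ico] at hj ⊢
          omega
      have := hleft m h
      omega
    · rw [Finset.sum_eq_zero]
      · omega
      · intro j hj
        rw [Finset.mem_Ico] at hj
        exact (hmid j (by omega) (by omega)).1

/-! ### Independence of functions of disjoint coordinates -/

section DependsOn

lemma exists_factor_of_dependsOn {ι β γ : Type*} [Nonempty β] {f : (ι → β) → γ} {S : Finset ι}
    (hf : DependsOn f (S : Set ι)) :
    ∃ g : (S → β) → γ, ∀ x, f x = g fun i => x i := by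
  classical
  -- Coordinates outside `S` get an arbitrary value, which `f` ignores.
  refine ⟨fun y => f fun i => if h : i ∈ S then y ⟨i, h⟩ else Classical.arbitrary β, fun x => ?_⟩
  refine hf fun i hi => ?_
  rw [dif_pos (Finset.mem_coe.1 hi)]

variable {Ω : Type v} [MeasurableSpace Ω] {μ : Measure Ω} {ι β γ : Type*}
  [MeasurableSpace β] [MeasurableSingletonClass β] [Countable β] [MeasurableSpace γ]

lemma measurable_of_dependsOn [Nonempty β] {Z : ι → Ω → β} (hZ : ∀ i, Measurable (Z i))
    {f : (ι → β) → γ} {S : Finset ι} (hf : DependsOn f (S : Set ι)) :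
    Measurable fun ω => f fun i => Z i ω := by
  obtain ⟨g, hg⟩ := exists_factor_of_dependsOn hf
  simp_rw [hg]
  exact (measurable_of_countable g).comp (measurable_pi_lambda _ fun i => hZ i)

lemma indepFun_of_dependsOn [Nonempty β] {γ' : Type*} [MeasurableSpace γ'] {Z : ι → Ω → β}
    (hZ : ∀ i, Measurable (Z i)) (hind : iIndepFun Z μ) {f : (ι → β) → γ} {f' : (ι → β) → γ'}
    {S S' : Finset ι} (hS : Disjoint S S') (hf : DependsOn f (S : Set ι))
    (hf' : DependsOn f' (S' : Set ι)) :
    IndepFun (fun ω => f fun i => Z i ω) (fun ω => f' fun i => Z i ω) μ := by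
  obtain ⟨g, hg⟩ := exists_factor_of_dependsOn hf
  obtain ⟨g', hg'⟩ := exists_factor_of_dependsOn hf'
  simp_rw [hg, hg']
  exact (hind.indepFun_finset S S' hS hZ).comp (measurable_of_countable g)
    (measurable_of_countable g')

/-- Functions of disjoint sets of coordinates of an independent family are independent. -/
lemma iIndepFun_of_dependsOn [Nonempty β] [IsProbabilityMeasure μ] {κ : Type*} {Z : ι → Ω → β}
    (hZ : ∀ i, Measurable (Z i)) (hind : iIndepFun Z μ) {φ : κ → (ι → β) → γ}
    {S : κ → Finset ι} (hS : Pairwise fun k l => Disjoint (S k) (S l))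
    (hφ : ∀ k, DependsOn (φ k) (S k : Set ι)) :
    iIndepFun (fun k ω => φ k fun i => Z i ω) μ := by
  classical
  rw [iIndepFun_iff_measure_inter_preimage_eq_mul]
  intro U A hA
  induction U using Finset.induction_on with
  | empty => simp
  | insert u U hu ih =>
    rw [Finset.prod_insert hu, ← ih fun i hi => hA i (Finset.mem_insert_of_mem hi),
      Finset.set_biInter_insert]
    have hdis : Disjoint (S u) (U.biUnion S) :=
      (Finset.disjoint_biUnion_right _ _ _).2 fun l hl => hS (by rintro rfl; exact hu hl)
    -- The events already treated are merged into one proposition-valued function of the union of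
    -- their coordinates, so that independence of two functions suffices.
    have hdep : DependsOn (fun x : ι → β => ∀ k ∈ U, φ k x ∈ A k) (U.biUnion S : Finset ι) := by
      intro x y hxy
      refine propext (forall₂_congr fun k hk => ?_)
      rw [hφ k fun i hi => hxy i (by
        rw [Finset.mem_coe, Finset.mem_biUnion]; exact ⟨k, hk, hi⟩)]
    have := (indepFun_of_dependsOn hZ hind hdis (hφ u) hdep).measure_inter_preimage_eq_mul
      (A u) {True} (hA u (Finset.mem_insert_self _ _)) trivial
    convert this using 3 <;>
    · ext ω
      simp

end DependsOn

/-! ### Probability of block pivots -/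

section Blocks

lemma sum_pow_le_of_injOn {ρ : ℝ} (h0 : 0 ≤ ρ) (h1 : ρ < 1) {U : Finset ℕ} {f : ℕ → ℕ}
    (hf : Set.InjOn f U) : ∑ m ∈ U, ρ ^ f m ≤ (1 - ρ)⁻¹ := by
  rw [← Finset.sum_image (f := fun l => ρ ^ l) hf, ← tsum_geometric_of_lt_one h0 h1]
  exact (summable_geometric_of_lt_one h0 h1).sum_le_tsum _ fun _ _ => by positivity

/-- Chernoff bound for the deficit of convergence opportunities over a set of blocks. -/
lemma measure_deficit_le {Ω : Type v} [MeasurableSpace Ω] {μ : Measure Ω} [IsProbabilityMeasure μ]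
    {B : ℕ} (hB : 1 ≤ B) {Y : ℕ → Ω → ℕ × ℕ} (hY : ∀ m, Measurable (Y m)) (hind : iIndepFun Y μ)
    (hYB : ∀ m ω, (Y m ω).1 ≤ B ∧ (Y m ω).2 ≤ B)
    (hmean : ∀ m, 1 ≤ ∫ ω, (((Y m ω).1 : ℝ) - (Y m ω).2) ∂μ) (S : Finset ℕ) (T : ℕ) :
    μ.real {ω | ∑ m ∈ S, (Y m ω).1 + T < ∑ m ∈ S, (Y m ω).2} ≤
      Real.exp (-(1 / B ^ 2 * T)) * Real.exp (-(1 / (2 * B ^ 2))) ^ S.card := by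
  rcases S.eq_empty_or_nonempty with rfl | hS
  · simp only [Finset.sum_empty, not_lt_zero, Set.ofPred_false, measureReal_empty]
    positivity
  have hB' : (0 : ℝ) < B := by exact_mod_cast hB
  set G : ℕ × ℕ → ℝ := fun y => (y.2 : ℝ) - y.1 with hG
  have hGm : Measurable G := measurable_of_countable G
  have hsub : ∀ m, HasSubgaussianMGF (fun ω => G (Y m ω) - ∫ ω', G (Y m ω') ∂μ)
      ((‖(B : ℝ) - (-B)‖₊ / 2) ^ 2) μ := fun m =>
    hasSubgaussianMGF_of_mem_Icc (hGm.comp (hY m)).aemeasurable (ae_of_all _ fun ω => by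
      obtain ⟨h1, h2⟩ := hYB m ω
      have h1' : ((Y m ω).1 : ℝ) ≤ B := by exact_mod_cast h1
      have h2' : ((Y m ω).2 : ℝ) ≤ B := by exact_mod_cast h2
      constructor <;> simp only [hG] <;> linarith [Nat.cast_nonneg (α := ℝ) (Y m ω).1,
        Nat.cast_nonneg (α := ℝ) (Y m ω).2])
  have hX : iIndepFun (fun m ω => G (Y m ω) - ∫ ω', G (Y m ω') ∂μ) μ :=
    hind.comp (fun m y => G y - ∫ ω', G (Y m ω') ∂μ) fun m => measurable_of_countable _
  have hc : (((‖(B : ℝ) - (-B)‖₊ / 2) ^ 2 : NNReal) : ℝ) = B ^ 2 := by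
    push_cast
    rw [Real.norm_of_nonneg (by linarith)]
    ring
  have hs : (1 : ℝ) ≤ S.card := by exact_mod_cast hS.card_pos
  -- Each mean is at most `-1`, so a deficit above `T` forces the centred sum to be at least `T +
  -- S.card`. The exponent is then simplified with `(T + s) ^ 2 ≥ 2 * T * s + s ^ 2`.
  have key := HasSubgaussianMGF.measure_sum_ge_le_of_iIndepFun hX (s := S) (fun m _ => hsub m)
    (ε := T + S.card) (by positivity)
  refine (measureReal_mono ?_).trans (key.trans ?_)
  · intro ω hω
    simp only [Set.mem_ofPred_eq] at hω ⊢
    have h1 : ∀ m, ∫ ω', G (Y m ω') ∂μ ≤ -1 := by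
      intro m
      have : ∫ ω', G (Y m ω') ∂μ = -∫ ω, (((Y m ω).1 : ℝ) - (Y m ω).2) ∂μ := by
        rw [← integral_neg]
        exact integral_congr_ae (ae_of_all _ fun ω => by simp [hG])
      linarith [hmean m]
    have h2 : (∑ m ∈ S, ((Y m ω).1 : ℝ)) + T ≤ ∑ m ∈ S, ((Y m ω).2 : ℝ) := by
      exact_mod_cast hω.le
    have h3 : ∑ m ∈ S, ∫ ω', G (Y m ω') ∂μ ≤ ∑ _m ∈ S, (-1 : ℝ) :=
      Finset.sum_le_sum fun m _ => h1 m
    rw [Finset.sum_const, nsmul_eq_mul] at h3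
    rw [Finset.sum_sub_distrib]
    simp only [hG, Finset.sum_sub_distrib] at h3 ⊢
    linarith
  · rw [← Real.exp_nat_mul, ← Real.exp_add, NNReal.coe_sum, Finset.sum_congr rfl fun m _ => hc,
      Finset.sum_const, nsmul_eq_mul]
    refine Real.exp_le_exp.2 ?_
    rw [neg_div, mul_neg, ← neg_add]
    refine neg_le_neg ?_
    rw [le_div_iff₀ (by positivity)]
    have : (1 / (B : ℝ) ^ 2 * T + S.card * (1 / (2 * (B : ℝ) ^ 2))) * (2 * (S.card * (B : ℝ) ^ 2)) =
        2 * T * S.card + (S.card : ℝ) ^ 2 := by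
      field_simp
    rw [this]
    nlinarith [Nat.cast_nonneg (α := ℝ) T]

/-- The part of the conditions for a block pivot that concerns the `M` blocks on both sides. -/
def PerfectAround (M m₀ : ℕ) (y : ℕ → ℕ × ℕ) : Prop :=
  ∀ m ∈ Finset.Icc (m₀ - M) (m₀ + M), (y m).2 = 0 ∧ 1 ≤ (y m).1

/-- There is no large deficit on both sides outside of `M` and inside of `R` blocks. -/
def NoDeficitAround (T M R m₀ : ℕ) (y : ℕ → ℕ × ℕ) : Prop :=
  (∀ m ∈ Finset.Ioc (m₀ + M) (m₀ + R + 1), ∑ j ∈ Finset.Ioo (m₀ + M) m, (y j).2 ≤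
    ∑ j ∈ Finset.Ioo (m₀ + M) m, (y j).1 + T) ∧
  ∀ m ∈ Finset.Ico (m₀ - R - 1) (m₀ - M), ∑ j ∈ Finset.Ioo m (m₀ - M), (y j).2 ≤
    ∑ j ∈ Finset.Ioo m (m₀ - M), (y j).1 + T

lemma dependsOn_perfectAround (M m₀ : ℕ) :
    DependsOn (PerfectAround M m₀) (Finset.Icc (m₀ - M) (m₀ + M) : Set ℕ) := by
  intro x y hxy
  refine propext (forall₂_congr fun m hm => ?_)
  rw [hxy m (Finset.mem_coe.2 hm)]

lemma dependsOn_noDeficitAround (T M R m₀ : ℕ) :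
    DependsOn (NoDeficitAround T M R m₀)
      ((Finset.Ioc (m₀ + M) (m₀ + R) ∪ Finset.Ico (m₀ - R) (m₀ - M) : Finset ℕ) : Set ℕ) := by
  intro x y hxy
  have h : ∀ l r, Finset.Ioo l r ⊆ Finset.Ioc (m₀ + M) (m₀ + R) ∪ Finset.Ico (m₀ - R) (m₀ - M) →
      ∑ j ∈ Finset.Ioo l r, (x j).2 = ∑ j ∈ Finset.Ioo l r, (y j).2 ∧
      ∑ j ∈ Finset.Ioo l r, (x j).1 = ∑ j ∈ Finset.Ioo l r, (y j).1 := fun l r hlr =>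
    ⟨Finset.sum_congr rfl fun j hj => by rw [hxy j (Finset.mem_coe.2 (hlr hj))],
      Finset.sum_congr rfl fun j hj => by rw [hxy j (Finset.mem_coe.2 (hlr hj))]⟩
  refine propext (and_congr (forall₂_congr fun m hm => ?_) (forall₂_congr fun m hm => ?_))
  · rw [(h _ _ _).1, (h _ _ _).2] <;>
    · intro j
      simp only [Finset.mem_Ioo, Finset.mem_union, Finset.mem_Ioc, Finset.mem_Ico] at hm ⊢
      omega
  · rw [(h _ _ _).1, (h _ _ _).2] <;>
    · intro j
      simp only [Finset.mem_Ioo, Finset.mem_union, Finset.mem_Ioc, Finset.mem_Ico] at hm ⊢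
      omega

/-- Short intervals are controlled by the local event, which reads only the blocks within distance
`R` of `m₀`; longer ones by `hglob`, which does not mention `m₀`. Only the local part has to be
independent between groups. -/
lemma isBlockPivot_of_around {y : ℕ → ℕ × ℕ} {B T M R K m₀ : ℕ} (hM : 2 * B + 1 ≤ M)
    (hT : T ≤ M - 2 * B) (hMR : M ≤ R) (hR : R ≤ m₀) (hK : m₀ ≤ K) (hyB : ∀ m, (y m).2 ≤ B)
    (h1 : PerfectAround M m₀ y) (h2 : NoDeficitAround T M R m₀ y)
    (hglob : ∀ l ≤ K, ∀ r ≤ K, l + (R - M) < r →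
      ∑ j ∈ Finset.Ioo l r, (y j).2 ≤ ∑ j ∈ Finset.Ioo l r, (y j).1) :
    IsBlockPivot (fun m => (y m).1) (fun m => (y m).2) K m₀ := by
  refine isBlockPivot_of_tails hM (hMR.trans hR) hyB
    (fun m _ _ => h1 m (Finset.mem_Icc.2 (by omega))) (fun m hm hmK => ?_) fun m hm => ?_
  · by_cases h : m ≤ m₀ + R + 1
    · exact (h2.1 m (Finset.mem_Ioc.2 ⟨hm, h⟩)).trans (by omega)
    · exact (hglob (m₀ + M) (by omega) m hmK (by omega)).trans (by omega)
  · by_cases h : m₀ ≤ m + R + 1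
    · exact (h2.2 m (Finset.mem_Ico.2 (by omega))).trans (by omega)
    · exact (hglob m (by omega) (m₀ - M) (by omega) (by omega)).trans (by omega)

/-- On each side the intervals have pairwise different lengths, so the union bound is a geometric
series, with a bound independent of `R`. -/
lemma measure_not_noDeficitAround_le {Ω : Type v} [MeasurableSpace Ω] {μ : Measure Ω}
    [IsProbabilityMeasure μ] {Y : ℕ → Ω → ℕ × ℕ} {C ρ : ℝ} (hC : 0 ≤ C) (hρ₀ : 0 ≤ ρ) (hρ₁ : ρ < 1)
    {T M R m₀ : ℕ}
    (hdef : ∀ S : Finset ℕ, μ.real {ω | ∑ m ∈ S, (Y m ω).1 + T < ∑ m ∈ S, (Y m ω).2} ≤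
      C * ρ ^ S.card) :
    μ.real {ω | ¬ NoDeficitAround T M R m₀ fun m => Y m ω} ≤ 2 * (C * (1 - ρ)⁻¹) := by
  set V := Finset.Ioc (m₀ + M) (m₀ + R + 1)
  set W := Finset.Ico (m₀ - R - 1) (m₀ - M)
  set D : Finset ℕ → Set Ω := fun S => {ω | ∑ m ∈ S, (Y m ω).1 + T < ∑ m ∈ S, (Y m ω).2} with hD
  have hsub : {ω | ¬ NoDeficitAround T M R m₀ fun m => Y m ω} ⊆
      (⋃ m ∈ V, D (Finset.Ioo (m₀ + M) m)) ∪ ⋃ m ∈ W, D (Finset.Ioo m (m₀ - M)) := by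
    intro ω hω
    simp only [NoDeficitAround, Set.mem_ofPred_eq, not_and_or, not_forall, not_le] at hω
    simp only [Set.mem_union, Set.mem_iUnion]
    exact hω.imp (fun ⟨m, hm, h⟩ => ⟨m, hm, h⟩) fun ⟨m, hm, h⟩ => ⟨m, hm, h⟩
  have hbd : ∀ (U : Finset ℕ) (f : ℕ → Finset ℕ), Set.InjOn (fun m => (f m).card) U →
      μ.real (⋃ m ∈ U, D (f m)) ≤ C * (1 - ρ)⁻¹ := fun U f hf => by
    refine (measureReal_biUnion_finset_le _ _).trans
      ((Finset.sum_le_sum fun m _ => hdef (f m)).trans ?_)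
    rw [← Finset.mul_sum]
    exact mul_le_mul_of_nonneg_left (sum_pow_le_of_injOn hρ₀ hρ₁ hf) hC
  refine (measureReal_mono hsub).trans ((measureReal_union_le _ _).trans ?_)
  have h1 := hbd V (fun m => Finset.Ioo (m₀ + M) m) (by
    intro x hx y hy hxy
    simp only [V, Finset.coe_Ioc, Set.mem_Ioc, Nat.card_Ioo] at hx hy hxy
    omega)
  have h2 := hbd W (fun m => Finset.Ioo m (m₀ - M)) (by
    intro x hx y hy hxy
    simp only [W, Finset.coe_Ico, Set.mem_Ico, Nat.card_Ioo] at hx hy hxy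
    omega)
  linarith

/-- Among sufficiently many groups of consecutive blocks some group is centred at a pivot, except
with small probability. -/
theorem exists_measure_no_blockPivot_le (B : ℕ) (hB : 1 ≤ B) (q : ℝ) (hq : 0 < q) :
    ∃ (M : ℕ) (δ η : ℝ), 0 < δ ∧ 0 < η ∧
      ∀ (Ω : Type v) [MeasurableSpace Ω] (μ : Measure Ω) [IsProbabilityMeasure μ]
        (Y : ℕ → Ω → ℕ × ℕ), (∀ m, Measurable (Y m)) → iIndepFun Y μ →
        (∀ m ω, (Y m ω).1 ≤ B ∧ (Y m ω).2 ≤ B) →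
        (∀ m, 1 ≤ ∫ ω, (((Y m ω).1 : ℝ) - (Y m ω).2) ∂μ) →
        (∀ m, q ≤ μ.real {ω | (Y m ω).2 = 0 ∧ 1 ≤ (Y m ω).1}) →
        ∀ K N R : ℕ, M ≤ R →
          μ.real {ω | ¬ ∀ g₀, (g₀ + N) * (2 * R + 1) ≤ K → ∃ g, g₀ ≤ g ∧ g < g₀ + N ∧
            IsBlockPivot (fun m => (Y m ω).1) (fun m => (Y m ω).2) K (g * (2 * R + 1) + R)} ≤
          (K + 1) * Real.exp (-(δ * N)) + (K + 1) ^ 2 * Real.exp (-(η * ((R : ℝ) - M))) := by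
  have hB' : (0 : ℝ) < B := by exact_mod_cast hB
  set ρ := Real.exp (-(1 / (2 * (B : ℝ) ^ 2))) with hρ
  have hρ₀ : 0 ≤ ρ := (Real.exp_pos _).le
  have hρ₁ : ρ < 1 := by
    rw [hρ, Real.exp_lt_one_iff]
    have : 0 < 1 / (2 * (B : ℝ) ^ 2) := by positivity
    linarith
  -- With this `T` the two geometric series add up to at most `1 / 2`, and `M` is then the least
  -- value allowing a deficit `T` in `isBlockPivot_of_around`.
  obtain ⟨T, hT⟩ : ∃ T : ℕ, Real.exp (-(1 / (B : ℝ) ^ 2 * T)) ≤ (1 - ρ) / 4 := by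
    have hlt : Real.exp (-(1 / (B : ℝ) ^ 2)) < 1 := by
      rw [Real.exp_lt_one_iff]
      have : 0 < 1 / (B : ℝ) ^ 2 := by positivity
      linarith
    obtain ⟨T, hT⟩ := exists_pow_lt_of_lt_one (show 0 < (1 - ρ) / 4 by linarith) hlt
    refine ⟨T, le_trans (le_of_eq ?_) hT.le⟩
    rw [← Real.exp_nat_mul]
    ring_nf
  set M := 2 * B + 1 + T with hM
  refine ⟨M, q ^ (2 * M + 1) * (1 / 2), 1 / (2 * (B : ℝ) ^ 2), by positivity, by positivity, ?_⟩
  intro Ω _ μ _ Y hY hind hYB hmean hqY K N R hMR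
  have hdef := fun S T => measure_deficit_le hB hY hind hYB hmean S T
  have hloc : ∀ m₀, M ≤ m₀ → q ^ (2 * M + 1) * (1 / 2) ≤
      μ.real {ω | PerfectAround M m₀ (fun m => Y m ω) ∧
        NoDeficitAround T M R m₀ fun m => Y m ω} := by
    intro m₀ hm₀
    have hdis : Disjoint (Finset.Icc (m₀ - M) (m₀ + M))
        (Finset.Ioc (m₀ + M) (m₀ + R) ∪ Finset.Ico (m₀ - R) (m₀ - M)) := by
      refine Finset.disjoint_left.2 fun j hj => ?_
      simp only [Finset.mem_Icc, Finset.mem_union, Finset.mem_Ioc, Finset.mem_Ico] at hj ⊢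
      omega
    have h1 : q ^ (2 * M + 1) ≤ μ.real {ω | PerfectAround M m₀ fun m => Y m ω} := by
      have := hind.measure_inter_preimage_eq_mul (Finset.Icc (m₀ - M) (m₀ + M))
        (sets := fun _ => {y | y.2 = 0 ∧ 1 ≤ y.1}) fun _ _ => (Set.to_countable _).measurableSet
      have heq : {ω | PerfectAround M m₀ fun m => Y m ω} =
          ⋂ i ∈ Finset.Icc (m₀ - M) (m₀ + M), Y i ⁻¹' {y | y.2 = 0 ∧ 1 ≤ y.1} := by
        ext ω; simp [PerfectAround]
      rw [heq, Measure.real, this, ENNReal.toReal_prod]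
      have hcard : (Finset.Icc (m₀ - M) (m₀ + M)).card = 2 * M + 1 := by
        rw [Nat.card_Icc]; omega
      rw [← hcard]
      rw [← Finset.prod_const]
      exact Finset.prod_le_prod (fun _ _ => hq.le) fun m _ => hqY m
    have h2 : 1 / 2 ≤ μ.real {ω | NoDeficitAround T M R m₀ fun m => Y m ω} := by
      have hb := measure_not_noDeficitAround_le (Real.exp_pos _).le hρ₀ hρ₁
        (M := M) (R := R) (m₀ := m₀) fun S => hdef S T
      have hmeas : MeasurableSet {ω | NoDeficitAround T M R m₀ fun m => Y m ω} :=
        measurableSet_setOfPred.2 (measurable_of_dependsOn hY (dependsOn_noDeficitAround T M R m₀))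
      have hc := probReal_compl_eq_one_sub (μ := μ) hmeas
      have : {ω | NoDeficitAround T M R m₀ fun m => Y m ω}ᶜ =
        {ω | ¬ NoDeficitAround T M R m₀ fun m => Y m ω} := rfl
      rw [this] at hc
      have h4 : Real.exp (-(1 / (B : ℝ) ^ 2 * T)) * (1 - ρ)⁻¹ ≤ 1 / 4 := by
        rw [← div_eq_mul_inv, div_le_iff₀ (by linarith)]
        linarith
      linarith
    have := (indepFun_of_dependsOn hY hind hdis (by simpa using dependsOn_perfectAround M m₀)
      (dependsOn_noDeficitAround T M R m₀)).measure_inter_preimage_eq_mul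
      {True} {True} trivial trivial
    have heq : {ω | PerfectAround M m₀ (fun m => Y m ω) ∧
        NoDeficitAround T M R m₀ fun m => Y m ω} =
        (fun ω => PerfectAround M m₀ fun m => Y m ω) ⁻¹' {True} ∩
        (fun ω => NoDeficitAround T M R m₀ fun m => Y m ω) ⁻¹' {True} := by
      ext ω; simp
    rw [heq, Measure.real, this, ENNReal.toReal_mul]
    refine mul_le_mul ?_ ?_ (by norm_num) ENNReal.toReal_nonneg
    · refine h1.trans_eq (congrArg (fun s => (μ s).toReal) ?_)
      ext ω; simp
    · refine h2.trans_eq (congrArg (fun s => (μ s).toReal) ?_)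
      ext ω; simp
  set δ := q ^ (2 * M + 1) * (1 / 2) with hδ
  set W := 2 * R + 1 with hW
  -- Group `g` consists of the `W = 2 * R + 1` blocks from `g * W` on, with centre `g * W + R`; the
  -- local event at the centre reads no block outside the group.
  set Loc : ℕ → (ℕ → ℕ × ℕ) → Prop := fun g y =>
    PerfectAround M (g * W + R) y ∧ NoDeficitAround T M R (g * W + R) y with hLoc
  have hLdep : ∀ g, DependsOn (Loc g) (Finset.Ico (g * W) ((g + 1) * W) : Set ℕ) := by
    intro g x y hxy
    have hr : (g + 1) * W = g * W + W := Nat.succ_mul _ _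
    refine propext (and_congr (Iff.of_eq ?_) (Iff.of_eq ?_))
    · refine (dependsOn_perfectAround M (g * W + R)) fun i hi => hxy i ?_
      simp only [Finset.coe_Icc, Set.mem_Icc, Finset.coe_Ico, Set.mem_Ico] at hi ⊢
      omega
    · refine (dependsOn_noDeficitAround T M R (g * W + R)) fun i hi => hxy i ?_
      simp only [Finset.coe_union, Finset.coe_Ioc, Finset.coe_Ico, Set.mem_union, Set.mem_Ioc,
        Set.mem_Ico] at hi ⊢
      omega
  have hdisj : Pairwise fun g g' : ℕ =>
      Disjoint (Finset.Ico (g * W) ((g + 1) * W)) (Finset.Ico (g' * W) ((g' + 1) * W)) := by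
    intro g g' hgg
    refine Finset.disjoint_left.2 fun j hj hj' => hgg ?_
    rw [Finset.mem_Ico] at hj hj'
    have e1 : j / W = g := (Nat.div_eq_iff (by omega)).2 ⟨hj.1, by
      have := hj.2; rw [Nat.succ_mul] at this; omega⟩
    have e2 : j / W = g' := (Nat.div_eq_iff (by omega)).2 ⟨hj'.1, by
      have := hj'.2; rw [Nat.succ_mul] at this; omega⟩
    omega
  have hLind := iIndepFun_of_dependsOn hY hind hdisj hLdep
  have hmiss : ∀ g₀, μ.real {ω | ∀ g ∈ Finset.Ico g₀ (g₀ + N), ¬ Loc g fun m => Y m ω} ≤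
      Real.exp (-(δ * N)) := by
    intro g₀
    have := hLind.measure_inter_preimage_eq_mul (Finset.Ico g₀ (g₀ + N)) (sets := fun _ => {False})
      fun _ _ => trivial
    have heq : {ω | ∀ g ∈ Finset.Ico g₀ (g₀ + N), ¬ Loc g fun m => Y m ω} =
        ⋂ g ∈ Finset.Ico g₀ (g₀ + N), (fun ω => Loc g fun m => Y m ω) ⁻¹' {False} := by
      ext ω; simp
    rw [heq, Measure.real, this, ENNReal.toReal_prod]
    have hexp : Real.exp (-(δ * N)) = ∏ _g ∈ Finset.Ico g₀ (g₀ + N), Real.exp (-δ) := by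
      rw [Finset.prod_const, Nat.card_Ico, ← Real.exp_nat_mul]
      congr 1
      rw [Nat.add_sub_cancel_left]
      ring
    rw [hexp]
    refine Finset.prod_le_prod (fun _ _ => ENNReal.toReal_nonneg) fun g _ => ?_
    have hmeas : MeasurableSet {ω | Loc g fun m => Y m ω} :=
      measurableSet_setOfPred.2 (measurable_of_dependsOn hY (hLdep g))
    have hc := probReal_compl_eq_one_sub (μ := μ) hmeas
    have hset : (fun ω => Loc g fun m => Y m ω) ⁻¹' {False} = {ω | Loc g fun m => Y m ω}ᶜ := by
      ext ω; simp
    have h1 := hloc (g * W + R) (by omega)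
    have h2 := Real.add_one_le_exp (-δ)
    rw [hset]
    change μ.real _ ≤ _
    rw [hc]
    change δ ≤ μ.real {ω | Loc g fun m => Y m ω} at h1
    linarith
  set Gl : ℕ × ℕ → Set Ω := fun x =>
    {ω | x.1 + (R - M) < x.2 ∧ ∑ j ∈ Finset.Ioo x.1 x.2, (Y j ω).1 + 0 <
      ∑ j ∈ Finset.Ioo x.1 x.2, (Y j ω).2} with hGl
  have hGlb : ∀ x, μ.real (Gl x) ≤ Real.exp (-(1 / (2 * (B : ℝ) ^ 2) * ((R : ℝ) - M))) := by
    intro x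
    by_cases hx : x.1 + (R - M) < x.2
    · refine (measureReal_mono (fun ω hω => hω.2)).trans ((hdef (Finset.Ioo x.1 x.2) 0).trans ?_)
      rw [Nat.cast_zero, mul_zero, neg_zero, Real.exp_zero, one_mul, ← hρ]
      refine (pow_le_pow_of_le_one hρ₀ hρ₁.le (show R - M ≤ _ by rw [Nat.card_Ioo]; omega)).trans ?_
      rw [hρ, ← Real.exp_nat_mul, Nat.cast_sub hMR]
      exact le_of_eq (by ring_nf)
    · have : Gl x = ∅ := by
        ext ω; simp [hGl, hx]
      rw [this, measureReal_empty]
      exact (Real.exp_pos _).le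
  have hsub : {ω | ¬ ∀ g₀, (g₀ + N) * W ≤ K → ∃ g, g₀ ≤ g ∧ g < g₀ + N ∧
      IsBlockPivot (fun m => (Y m ω).1) (fun m => (Y m ω).2) K (g * W + R)} ⊆
      (⋃ g₀ ∈ Finset.range (K + 1),
        {ω | ∀ g ∈ Finset.Ico g₀ (g₀ + N), ¬ Loc g fun m => Y m ω}) ∪
      ⋃ x ∈ Finset.range (K + 1) ×ˢ Finset.range (K + 1), Gl x := by
    intro ω hω
    simp only [Set.mem_ofPred_eq] at hω
    by_contra hnot
    refine hω fun g₀ hg₀ => ?_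
    simp only [Set.mem_union, Set.mem_iUnion, not_or, not_exists, Set.mem_ofPred_eq, hGl,
      Finset.mem_product, Finset.mem_range, not_and, not_forall, not_not, not_lt, exists_prop,
      add_zero] at hnot
    -- As `W ≥ 1`, the first group satisfies `g₀ ≤ K`, so the union bound over `K + 1` values is
    -- enough.
    obtain ⟨g, hg, hL⟩ := hnot.1 g₀ (by nlinarith)
    rw [Finset.mem_Ico] at hg
    have hgW : (g + 1) * W ≤ (g₀ + N) * W := Nat.mul_le_mul_right _ hg.2
    have hr : (g + 1) * W = g * W + W := Nat.succ_mul _ _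
    refine ⟨g, hg.1, hg.2, isBlockPivot_of_around (B := B) (by omega) (show T ≤ _ by omega) hMR
      (by omega) (by omega) (fun m => (hYB m ω).2) hL.1 hL.2 fun l hl r hr' hlr => ?_⟩
    exact hnot.2 (l, r) ⟨by omega, by omega⟩ hlr
  refine (measureReal_mono hsub).trans ((measureReal_union_le _ _).trans (add_le_add ?_ ?_))
  · refine (measureReal_biUnion_finset_le _ _).trans
      ((Finset.sum_le_sum fun g _ => hmiss g).trans (le_of_eq ?_))
    rw [Finset.sum_const, Finset.card_range, nsmul_eq_mul]
    push_cast
    ring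
  · refine (measureReal_biUnion_finset_le _ _).trans
      ((Finset.sum_le_sum fun x _ => hGlb x).trans (le_of_eq ?_))
    rw [Finset.sum_const, Finset.card_product, Finset.card_range, nsmul_eq_mul]
    push_cast
    ring

end Blocks

/-! ### The honest lottery and its independence of the adversary -/

section Lottery

variable {n : ℕ}

/-- A canonical subset with `h` elements. -/
noncomputable def pick (h : ℕ) (S : Finset (Fin n)) : Finset (Fin n) :=
  if H : h ≤ S.card then (Finset.exists_subset_card_eq H).choose else ∅

lemma pick_subset (h : ℕ) (S : Finset (Fin n)) : pick h S ⊆ S := by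
  unfold pick
  split_ifs with H
  · exact (Finset.exists_subset_card_eq H).choose_spec.1
  · exact Finset.empty_subset _

lemma card_pick {h : ℕ} {S : Finset (Fin n)} (H : h ≤ S.card) : (pick h S).card = h := by
  unfold pick
  rw [dif_pos H]
  exact (Finset.exists_subset_card_eq H).choose_spec.2

open Classical in
/-- Outcome of the lottery among honest nodes in one slot: `0` if nobody wins, `1` if a node of `S`
is the only winner, and `2` otherwise. -/
noncomputable def honestOutcome (corrupt S : Finset (Fin n)) (w : Fin n → Prop) : ℕ :=
  if ∀ j ∉ corrupt, ¬ w j then 0 else if ∃ i ∈ S, ∀ j ∉ corrupt, w j ↔ j = i then 1 else 2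

lemma honestOutcome_eq_zero {corrupt S : Finset (Fin n)} {w : Fin n → Prop} :
    honestOutcome corrupt S w = 0 ↔ ∀ j ∉ corrupt, ¬ w j := by
  unfold honestOutcome
  split_ifs <;> simp_all

lemma honestOutcome_eq_one {corrupt S : Finset (Fin n)} {w : Fin n → Prop}
    (hS : Disjoint S corrupt) :
    honestOutcome corrupt S w = 1 ↔ ∃ i ∈ S, ∀ j ∉ corrupt, w j ↔ j = i := by
  unfold honestOutcome
  split_ifs with h1 h2
  · simp only [false_iff]
    rintro ⟨i, hi, h⟩
    have hic := Finset.disjoint_left.1 hS hi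
    exact h1 i hic ((h i hic).2 rfl)
  · simp [h2]
  · simp [h2]

lemma honestOutcome_lt (corrupt S : Finset (Fin n)) (w : Fin n → Prop) :
    honestOutcome corrupt S w < 3 := by
  unfold honestOutcome
  split_ifs <;> norm_num

variable {Ω : Type v}

lemma measurable_honestOutcome {m : MeasurableSpace Ω} {corrupt S : Finset (Fin n)}
    {w : Ω → Fin n → Prop} (hw : ∀ i ∉ corrupt, MeasurableSet[m] {ω | w ω i}) :
    Measurable[m] fun ω => honestOutcome corrupt S (w ω) := by
  unfold honestOutcome
  have hw' : ∀ i ∉ corrupt, Measurable[m] fun ω => w ω i := fun i hi =>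
    measurableSet_setOfPred.1 (hw i hi)
  refine Measurable.ite ?_ measurable_const (Measurable.ite ?_ measurable_const measurable_const)
  · refine measurableSet_setOfPred.2 (Measurable.forall fun j => ?_)
    by_cases hj : j ∈ corrupt
    · simp [hj]
    · simpa [hj] using (hw' j hj).not
  · refine measurableSet_setOfPred.2 (Measurable.exists fun i => ?_)
    refine Measurable.and measurable_const (Measurable.forall fun j => ?_)
    by_cases hj : j ∈ corrupt
    · simp [hj]
    · simpa [hj] using (hw' j hj).iff measurable_const

lemma measurableSet_eq_of_mem {m : MeasurableSpace Ω} {G : Ω → Finset (Fin n)}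
    (hG : ∀ i, MeasurableSet[m] {ω | i ∈ G ω}) (S : Finset (Fin n)) :
    MeasurableSet[m] {ω | G ω = S} := by
  have : {ω | G ω = S} = {ω | ∀ i, i ∈ G ω ↔ i ∈ S} := by
    ext ω; simp [Finset.ext_iff]
  rw [this]
  exact measurableSet_setOfPred.2 (Measurable.forall fun i =>
    (measurableSet_setOfPred.1 (hG i)).iff measurable_const)

variable [mΩ : MeasurableSpace Ω] {μ : Measure Ω}

/-- The law of a variable with values `0`, `1`, `2` is given by the probabilities of `0` and `1`. -/
lemma measure_preimage_eq_of_lt_three [IsProbabilityMeasure μ] {X X' : Ω → ℕ} (hX : Measurable X) (hX' : Measurable X')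
    (h3 : ∀ ω, X ω < 3) (h3' : ∀ ω, X' ω < 3) (h0 : μ (X ⁻¹' {0}) = μ (X' ⁻¹' {0}))
    (h1 : μ (X ⁻¹' {1}) = μ (X' ⁻¹' {1})) (A : Set ℕ) : μ (X ⁻¹' A) = μ (X' ⁻¹' A) := by
  have h2 : ∀ {Y : Ω → ℕ}, Measurable Y → (∀ ω, Y ω < 3) →
      μ (Y ⁻¹' {2}) = 1 - (μ (Y ⁻¹' {0}) + μ (Y ⁻¹' {1})) := by
    intro Y hY hY3
    have hd : Disjoint (Y ⁻¹' {0}) (Y ⁻¹' {1}) :=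
      Disjoint.preimage _ (by simp)
    rw [← measure_union hd (hY (measurableSet_singleton _)), ← prob_compl_eq_one_sub
      ((hY (measurableSet_singleton _)).union (hY (measurableSet_singleton _)))]
    congr 1
    ext ω
    have := hY3 ω
    simp only [Set.mem_preimage, Set.mem_singleton_iff, Set.mem_compl_iff, Set.mem_union]
    omega
  have hmap : μ.map X = μ.map X' := by
    refine Measure.ext_of_singleton fun x => ?_
    rw [Measure.map_apply hX (measurableSet_singleton _),
      Measure.map_apply hX' (measurableSet_singleton _)]
    rcases Nat.lt_or_ge x 3 with hx | hx
    · interval_cases x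
      · exact h0
      · exact h1
      · rw [h2 hX h3, h2 hX' h3', h0, h1]
    · have hem : ∀ {Y : Ω → ℕ}, (∀ ω, Y ω < 3) → Y ⁻¹' {x} = ∅ := by
        intro Y hY
        ext ω
        have := hY ω
        simp only [Set.mem_preimage, Set.mem_singleton_iff, Set.mem_empty_iff_false, iff_false]
        omega
      rw [hem h3, hem h3']
  rw [← Measure.map_apply hX (Set.to_countable A).measurableSet,
    ← Measure.map_apply hX' (Set.to_countable A).measurableSet, hmap]

variable {corrupt : Finset (Fin n)} {p : ℝ} {F : Filtration ℕ mΩ} {win : Ω → Fin n → ℕ → Prop}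

namespace IsLottery

lemma measurableSet_win (hL : IsLottery μ corrupt p F win) (i : Fin n) (t : ℕ) :
    MeasurableSet {ω | win ω i t} := by
  by_cases hi : i ∈ corrupt
  · exact F.le 0 _ (hL.corrupt_known i hi t)
  · exact F.le (t + 1) _ (hL.honest_adapted i hi t)

lemma measure_noWinner [IsProbabilityMeasure μ] (hL : IsLottery μ corrupt p F win) (S : Finset (Fin n)) (t : ℕ) :
    μ ((fun ω => honestOutcome corrupt S fun j => win ω j t) ⁻¹' {0}) =
      (1 - ENNReal.ofReal p) ^ corruptᶜ.card := by
  have hi : iIndepSet ((fun x : Fin n × ℕ => {ω | win ω x.1 x.2}) ∘ fun j : Fin n => (j, t)) μ :=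
    hL.indep.precomp fun a b h => (Prod.mk.inj h).1
  have := iIndep.meas_biInter (S := corruptᶜ) (s := fun j => {ω | win ω j t}ᶜ) hi fun j _ =>
    (MeasurableSpace.measurableSet_generateFrom (by simp)).compl
  rw [Finset.prod_congr rfl fun j _ => by
    rw [prob_compl_eq_one_sub (hL.measurableSet_win j t), hL.prob], Finset.prod_const] at this
  rw [← this]
  congr 1
  ext ω
  simp [honestOutcome_eq_zero]

/-- The events "`i` is the only honest winner" are disjoint and equally likely. What matters is that
`S` enters only through its size, so the adaptive choice of awake nodes has no influence on the law.
-/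
lemma measure_uniqueWinner [IsProbabilityMeasure μ] (hL : IsLottery μ corrupt p F win) {S : Finset (Fin n)}
    (hS : Disjoint S corrupt) (t : ℕ) :
    μ ((fun ω => honestOutcome corrupt S fun j => win ω j t) ⁻¹' {1}) =
      S.card * (ENNReal.ofReal p * (1 - ENNReal.ofReal p) ^ (corruptᶜ.card - 1)) := by
  have hi : iIndepSet ((fun x : Fin n × ℕ => {ω | win ω x.1 x.2}) ∘ fun j : Fin n => (j, t)) μ :=
    hL.indep.precomp fun a b h => (Prod.mk.inj h).1
  have hm : ∀ i, MeasurableSet {ω | ∀ j ∉ corrupt, win ω j t ↔ j = i} := fun i =>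
    measurableSet_setOfPred.2 (Measurable.forall fun j => Measurable.imp measurable_const
      ((measurableSet_setOfPred.1 (hL.measurableSet_win j t)).iff measurable_const))
  have h1 : ∀ i ∈ S, μ {ω | ∀ j ∉ corrupt, win ω j t ↔ j = i} =
      ENNReal.ofReal p * (1 - ENNReal.ofReal p) ^ (corruptᶜ.card - 1) := by
    intro i hiS
    have hic : i ∈ corruptᶜ := Finset.mem_compl.2 (Finset.disjoint_left.1 hS hiS)
    have := iIndep.meas_biInter (S := corruptᶜ)
      (s := fun j => if j = i then {ω | win ω j t} else {ω | win ω j t}ᶜ) hi fun j _ => by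
        have : MeasurableSet[MeasurableSpace.generateFrom {{ω | win ω j t}}] {ω | win ω j t} :=
          MeasurableSpace.measurableSet_generateFrom (by simp)
        split_ifs
        exacts [this, this.compl]
    rw [← Finset.mul_prod_erase _ _ hic, if_pos rfl, hL.prob,
      Finset.prod_congr rfl fun j hj => by
        rw [if_neg (Finset.ne_of_mem_erase hj),
          prob_compl_eq_one_sub (hL.measurableSet_win j t), hL.prob],
      Finset.prod_const, Finset.card_erase_of_mem hic] at this
    rw [← this]
    congr 1
    ext ω
    simp only [Set.mem_ofPred_eq, Set.mem_iInter, Finset.mem_compl]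
    refine forall₂_congr fun j hj => ?_
    split_ifs with h <;> simp [h]
  have h2 : (fun ω => honestOutcome corrupt S fun j => win ω j t) ⁻¹' {1} =
      ⋃ i ∈ S, {ω | ∀ j ∉ corrupt, win ω j t ↔ j = i} := by
    ext ω
    simp only [Set.mem_preimage, Set.mem_singleton_iff, honestOutcome_eq_one hS, Set.mem_iUnion,
      Set.mem_ofPred_eq, exists_prop]
  rw [h2, measure_biUnion_finset _ fun i _ => hm i, Finset.sum_congr rfl h1, Finset.sum_const,
    nsmul_eq_mul]
  intro i hi' i' hi'' hne
  refine Set.disjoint_left.2 fun ω h h' => hne ?_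
  have hic := Finset.disjoint_left.1 hS hi'
  exact (h' i hic).1 ((h i hic).2 rfl)

variable {A : Ω → ℕ → Finset (Fin n)} {h : ℕ}

/-- The outcome among honest nodes in slot `t`, with awake nodes chosen on the basis of `F t`, is
independent of `F t`, and its law does not depend on the choice. -/
lemma measure_honestOutcome_inter [IsProbabilityMeasure μ] (hL : IsLottery μ corrupt p F win) {t : ℕ}
    (hA : ∀ i, MeasurableSet[F t] {ω | i ∈ A ω t}) (hAc : ∀ ω, Disjoint (A ω t) corrupt)
    (hAh : ∀ ω, h ≤ (A ω t).card) {S : Finset (Fin n)} (hS : Disjoint S corrupt)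
    (hSh : S.card = h) (B : Set ℕ) {Q : Set Ω} (hQ : MeasurableSet[F t] Q) :
    μ ((fun ω => honestOutcome corrupt (pick h (A ω t)) fun j => win ω j t) ⁻¹' B ∩ Q) =
      μ ((fun ω => honestOutcome corrupt S fun j => win ω j t) ⁻¹' B) * μ Q := by
  set X : Finset (Fin n) → Ω → ℕ := fun S ω => honestOutcome corrupt S fun j => win ω j t with hX
  have hXm : ∀ S, Measurable (X S) := fun S =>
    measurable_honestOutcome fun i _ => hL.measurableSet_win i t
  have hAS : ∀ S : Finset (Fin n), MeasurableSet[F t] {ω | A ω t = S} :=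
    measurableSet_eq_of_mem hA
  -- For a fixed value `S'` of the awake set the outcome is a function of honest tickets of slot
  -- `t`, hence independent of `F t`; the cases are then summed over the finitely many `S'`.
  have hprod : ∀ S', μ (X (pick h S') ⁻¹' B ∩ ({ω | A ω t = S'} ∩ Q)) =
      μ (X S ⁻¹' B) * μ ({ω | A ω t = S'} ∩ Q) := by
    intro S'
    by_cases hne : ∃ ω, A ω t = S'
    · obtain ⟨ω₀, h₀⟩ := hne
      have hd : Disjoint (pick h S') corrupt :=
        Finset.disjoint_of_subset_left (pick_subset _ _) (h₀ ▸ hAc ω₀)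
      have hmeas := measurable_honestOutcome (corrupt := corrupt) (S := pick h S')
        (w := fun ω j => win ω j t) (m := MeasurableSpace.generateFrom
        {A | ∃ i, i ∉ corrupt ∧ ∃ s, t ≤ s ∧ A = {ω | win ω i s}}) (fun i hi =>
          MeasurableSpace.measurableSet_generateFrom ⟨i, hi, t, le_rfl, rfl⟩)
          (Set.to_countable B).measurableSet
      have hi := (Indep_iff _ _ μ).1 (hL.unpredictable t) _ _ ((hAS S').inter hQ) hmeas
      rw [Set.inter_comm, hi, mul_comm]
      congr 1
      refine measure_preimage_eq_of_lt_three (hXm _) (hXm _) (fun ω => honestOutcome_lt _ _ _)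
        (fun ω => honestOutcome_lt _ _ _) ?_ ?_ B
      · rw [hL.measure_noWinner, hL.measure_noWinner]
      · rw [hL.measure_uniqueWinner hd, hL.measure_uniqueWinner hS, hSh,
          card_pick (h₀ ▸ hAh ω₀)]
    · have : {ω | A ω t = S'} = ∅ := by
        ext ω; simp only [Set.mem_ofPred_eq, Set.mem_empty_iff_false, iff_false]
        exact fun h => hne ⟨ω, h⟩
      rw [this]; simp
  have hQ' : Q = ⋃ S' ∈ (Finset.univ : Finset (Finset (Fin n))), ({ω | A ω t = S'} ∩ Q) := by
    ext ω; simp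
  have hX' : (fun ω => honestOutcome corrupt (pick h (A ω t)) fun j => win ω j t) ⁻¹' B ∩ Q =
      ⋃ S' ∈ (Finset.univ : Finset (Finset (Fin n))),
        (X (pick h S') ⁻¹' B ∩ ({ω | A ω t = S'} ∩ Q)) := by
    ext ω; simp [hX]
  have hdis : ∀ G : Finset (Fin n) → Set Ω, (∀ S', G S' ⊆ {ω | A ω t = S'}) →
      (↑(Finset.univ : Finset (Finset (Fin n))) : Set _).PairwiseDisjoint G := by
    intro G hG S₁ _ S₂ _ hne
    refine Set.disjoint_left.2 fun ω h1 h2 => hne ?_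
    exact (hG S₁ h1).symm.trans (hG S₂ h2)
  have hm1 : ∀ S', MeasurableSet ({ω | A ω t = S'} ∩ Q) := fun S' =>
    F.le t _ ((hAS S').inter hQ)
  rw [hX', measure_biUnion_finset (hdis _ fun S' ω hω => hω.2.1) fun S' _ =>
    (hXm _ (Set.to_countable B).measurableSet).inter (hm1 S'), Finset.sum_congr rfl fun S' _ =>
    hprod S', ← Finset.mul_sum, ← measure_biUnion_finset (hdis _ fun S' ω hω => hω.1) fun S' _ =>
    hm1 S', ← hQ']

end IsLottery

open Classical in
/-- The independent random variables that drive the execution. For `none`: the outcome among honest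
nodes in slot `t + 1`, with a single winner counted if it is in a set of `h` awake nodes; for
`some i`: the ticket of an adversarial node `i` for slot `t + 1`. -/
noncomputable def ticket (corrupt : Finset (Fin n)) (h : ℕ) (A : Ω → ℕ → Finset (Fin n))
    (win : Ω → Fin n → ℕ → Prop) : Option (Fin n) × ℕ → Ω → ℕ
  | (none, t), ω => honestOutcome corrupt (pick h (A ω (t + 1))) fun j => win ω j (t + 1)
  | (some i, t), ω => if i ∈ corrupt ∧ win ω i (t + 1) then 1 else 0

namespace IsLottery

variable {A : Ω → ℕ → Finset (Fin n)} {h : ℕ}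

lemma measurable_ticket_none (hL : IsLottery μ corrupt p F win)
    (hA : ∀ t i, MeasurableSet[F t] {ω | i ∈ A ω t}) (t : ℕ) :
    Measurable[F (t + 2)] (ticket corrupt h A win (none, t)) := by
  have hset : ∀ S : Finset (Fin n), MeasurableSet[F (t + 2)] {ω | A ω (t + 1) = S} :=
    measurableSet_eq_of_mem fun i => F.mono (Nat.le_succ _) _ (hA (t + 1) i)
  intro B _
  have : ticket corrupt h A win (none, t) ⁻¹' B = ⋃ S : Finset (Fin n), ({ω | A ω (t + 1) = S} ∩
      (fun ω => honestOutcome corrupt (pick h S) fun j => win ω j (t + 1)) ⁻¹' B) := by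
    ext ω; simp [ticket]
  rw [this]
  exact MeasurableSet.iUnion fun S => (hset S).inter (measurable_honestOutcome
    (fun i hi => hL.honest_adapted i hi (t + 1)) (Set.to_countable B).measurableSet)

lemma measurable_ticket (hL : IsLottery μ corrupt p F win)
    (hA : ∀ t i, MeasurableSet[F t] {ω | i ∈ A ω t}) (x : Option (Fin n) × ℕ) :
    Measurable (ticket corrupt h A win x) := by
  obtain ⟨_ | i, t⟩ := x
  · exact (hL.measurable_ticket_none hA t).mono (F.le _) le_rfl
  · unfold ticket
    refine Measurable.ite ?_ measurable_const measurable_const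
    exact measurableSet_setOfPred.2 (measurable_const.and
      (measurableSet_setOfPred.1 (hL.measurableSet_win i (t + 1))))

/-- The tickets are independent. -/
theorem iIndepFun_ticket [IsProbabilityMeasure μ] (hL : IsLottery μ corrupt p F win)
    (hA : ∀ t i, MeasurableSet[F t] {ω | i ∈ A ω t})
    (hAc : ∀ ω, ∀ t, 1 ≤ t → Disjoint (A ω t) corrupt)
    (hAh : ∀ ω, ∀ t, 1 ≤ t → h ≤ (A ω t).card) :
    iIndepFun (ticket corrupt h A win) μ := by
  classical
  obtain ⟨ω₀⟩ : Nonempty Ω := nonempty_of_isProbabilityMeasure μ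
  -- The latest slot is split off: the event `Q` and all earlier honest outcomes are known in the
  -- filtration at that slot. Events of adversarial tickets are admissible as `Q` since they lie in
  -- `F 0`.
  have hnone : ∀ (U : Finset ℕ) (B : ℕ → Set ℕ) (Q : Set Ω), MeasurableSet[F 0] Q →
      μ ((⋂ t ∈ U, ticket corrupt h A win (none, t) ⁻¹' B t) ∩ Q) =
        (∏ t ∈ U, μ (ticket corrupt h A win (none, t) ⁻¹' B t)) * μ Q := by
    intro U B Q hQ
    induction U using Finset.induction_on_max with
    | empty => simp
    | insert t U hmax ih =>
      have htU : t ∉ U := fun ht => lt_irrefl _ (hmax t ht)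
      have key := fun {Q' : Set Ω} (hQ' : MeasurableSet[F (t + 1)] Q') =>
        hL.measure_honestOutcome_inter (t := t + 1) (hA (t + 1)) (fun ω => hAc ω _ (by omega))
          (fun ω => hAh ω _ (by omega)) (Finset.disjoint_of_subset_left (pick_subset h _)
          (hAc ω₀ (t + 1) (by omega))) (card_pick (hAh ω₀ (t + 1) (by omega))) (B t) hQ'
      have h1 := key MeasurableSet.univ
      rw [Set.inter_univ, measure_univ, mul_one] at h1
      rw [Finset.prod_insert htU, Finset.set_biInter_insert, Set.inter_assoc, mul_assoc, ← ih]
      refine (key ?_).trans (by rw [← h1]; rfl)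
      refine MeasurableSet.inter ?_ (F.mono (Nat.zero_le _) _ hQ)
      refine Finset.measurableSet_biInter U fun s hs => ?_
      exact F.mono (by have := hmax s hs; omega) _
        (hL.measurable_ticket_none hA s (Set.to_countable (B s)).measurableSet)
  rw [iIndepFun_iff_measure_inter_preimage_eq_mul]
  intro S B _
  set U : Finset ℕ := (S.filter fun x => x.1 = none).image Prod.snd with hU
  set V : Finset (Fin n × ℕ) :=
    (Finset.univ ×ˢ S.image Prod.snd).filter fun x => (some x.1, x.2) ∈ S with hV
  have hmU : ∀ t, t ∈ U ↔ (none, t) ∈ S := fun t => by simp [hU]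
  have hmV : ∀ x : Fin n × ℕ, x ∈ V ↔ (some x.1, x.2) ∈ S := fun x => by
    simp only [hV, Finset.mem_filter, Finset.mem_product, Finset.mem_univ, true_and,
      and_iff_right_iff_imp]
    exact fun hx => Finset.mem_image_of_mem Prod.snd hx
  clear_value U V
  have hS : S = U.image (fun t => (none, t)) ∪ V.image fun x => (some x.1, x.2) := by
    ext ⟨o, t⟩
    rcases o with _ | i <;> simp [hmU, hmV]
  have hdisj : Disjoint (U.image fun t => ((none : Option (Fin n)), t))
      (V.image fun x => (some x.1, x.2)) := by
    refine Finset.disjoint_left.2 fun x hx hx' => ?_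
    obtain ⟨a, -, rfl⟩ := Finset.mem_image.1 hx
    obtain ⟨b, -, hb⟩ := Finset.mem_image.1 hx'
    simp at hb
  have hinter : ⋂ x ∈ S, ticket corrupt h A win x ⁻¹' B x =
      (⋂ t ∈ U, ticket corrupt h A win (none, t) ⁻¹' B (none, t)) ∩
        ⋂ x ∈ V, ticket corrupt h A win (some x.1, x.2) ⁻¹' B (some x.1, x.2) := by
    ext ω
    simp only [Set.mem_iInter, Set.mem_inter_iff, hmU, hmV]
    refine ⟨fun H => ⟨fun t ht => H _ ht, fun x hx => H _ hx⟩, fun H x hx => ?_⟩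
    obtain ⟨_ | i, t⟩ := x
    exacts [H.1 t hx, H.2 (i, t) hx]
  have hsome : ∀ x : Fin n × ℕ, MeasurableSet[MeasurableSpace.generateFrom
      {{ω | win ω x.1 (x.2 + 1)}}] (ticket corrupt h A win (some x.1, x.2) ⁻¹' B (some x.1, x.2)) ∧
      MeasurableSet[F 0] (ticket corrupt h A win (some x.1, x.2) ⁻¹' B (some x.1, x.2)) := by
    intro x
    have gen : ∀ m : MeasurableSpace Ω, (x.1 ∈ corrupt → MeasurableSet[m] {ω | win ω x.1 (x.2 + 1)}) →
        MeasurableSet[m] (ticket corrupt h A win (some x.1, x.2) ⁻¹' B (some x.1, x.2)) := by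
      intro m hm
      have : Measurable[m] (ticket corrupt h A win (some x.1, x.2)) := by
        unfold ticket
        refine Measurable.ite ?_ measurable_const measurable_const
        by_cases hx : x.1 ∈ corrupt
        · simpa [hx] using hm hx
        · simp [hx]
      exact this (Set.to_countable _).measurableSet
    exact ⟨gen _ fun _ => MeasurableSpace.measurableSet_generateFrom (by simp),
      gen _ fun hx => hL.corrupt_known _ hx _⟩
  have hV' : μ (⋂ x ∈ V, ticket corrupt h A win (some x.1, x.2) ⁻¹' B (some x.1, x.2)) =
      ∏ x ∈ V, μ (ticket corrupt h A win (some x.1, x.2) ⁻¹' B (some x.1, x.2)) := by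
    have hi : iIndepSet ((fun x : Fin n × ℕ => {ω | win ω x.1 x.2}) ∘
        fun x : Fin n × ℕ => (x.1, x.2 + 1)) μ :=
      hL.indep.precomp fun a b hab => by
        rw [Prod.mk.injEq] at hab; exact Prod.ext hab.1 (by omega)
    exact iIndep.meas_biInter hi fun x _ => (hsome x).1
  have hprod : ∏ x ∈ S, μ (ticket corrupt h A win x ⁻¹' B x) =
      (∏ t ∈ U, μ (ticket corrupt h A win (none, t) ⁻¹' B (none, t))) *
        ∏ x ∈ V, μ (ticket corrupt h A win (some x.1, x.2) ⁻¹' B (some x.1, x.2)) := by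
    conv_lhs => rw [hS]
    rw [Finset.prod_union hdisj, Finset.prod_image, Finset.prod_image]
    · intro a _ b _ hab
      simp only [Prod.mk.injEq, Option.some_inj] at hab
      exact Prod.ext hab.1 hab.2
    · intro a _ b _ hab
      exact (Prod.mk.inj hab).2
  rw [hinter, hprod, hnone U (fun t => B (none, t)) _
    (Finset.measurableSet_biInter V fun x _ => (hsome x).2), hV']

end IsLottery

end Lottery

/-! ### Counts of isolated wins and adversarial slots in a block -/

section Counts

variable {n : ℕ}

/-- The honest outcomes `z` are `1` at `t` and `0` within a distance below `Δ`. -/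
def IsIsolated (Δ t : ℕ) (z : Option (Fin n) × ℕ → ℕ) : Prop :=
  z (none, t) = 1 ∧ ∀ v ∈ Finset.Ioo (t - Δ) (t + Δ), v ≠ t → z (none, v) = 0

open Classical in
/-- Number of isolated honest wins in the interior of a block of `B` slots. -/
noncomputable def convCount (Δ B m : ℕ) (z : Option (Fin n) × ℕ → ℕ) : ℕ :=
  ((Finset.Ico (m * B + Δ) ((m + 1) * B - Δ)).filter fun t => IsIsolated Δ t z).card

open Classical in
/-- Number of slots with adversarial wins in a block of `B` slots. -/
noncomputable def advCount (B m : ℕ) (z : Option (Fin n) × ℕ → ℕ) : ℕ :=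
  ((Finset.Ico (m * B) ((m + 1) * B)).filter fun t => ∃ i : Fin n, z (some i, t) = 1).card

open Classical in
lemma convCount_le (Δ B m : ℕ) (z : Option (Fin n) × ℕ → ℕ) : convCount Δ B m z ≤ B := by
  refine (Finset.card_filter_le _ _).trans ?_
  rw [Nat.card_Ico, Nat.succ_mul]
  omega

open Classical in
lemma advCount_le (B m : ℕ) (z : Option (Fin n) × ℕ → ℕ) : advCount B m z ≤ B := by
  refine (Finset.card_filter_le _ _).trans ?_
  rw [Nat.card_Ico, Nat.succ_mul]
  omega

open Classical in
-- Isolation looks less than `Δ` indices to both sides. `convCount` leaves out `Δ` indices at each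
-- end of the block, so it reads this block only; this makes the counts of different blocks
-- independent.
lemma dependsOn_counts (Δ B m : ℕ) :
    DependsOn (fun z : Option (Fin n) × ℕ → ℕ => (convCount Δ B m z, advCount B m z))
      ((Finset.univ ×ˢ Finset.Ico (m * B) ((m + 1) * B) : Finset (Option (Fin n) × ℕ)) : Set _) := by
  intro x y hxy
  have h : ∀ o t, t ∈ Finset.Ico (m * B) ((m + 1) * B) → x (o, t) = y (o, t) := fun o t ht =>
    hxy (o, t) (by rw [Finset.mem_coe, Finset.mem_product]; exact ⟨Finset.mem_univ _, ht⟩)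
  dsimp only
  congr 1
  · unfold convCount
    congr 1
    refine Finset.filter_congr fun t ht => ?_
    rw [Finset.mem_Ico] at ht
    unfold IsIsolated
    rw [h none t (Finset.mem_Ico.2 (by omega))]
    refine and_congr Iff.rfl (forall₂_congr fun v hv => ?_)
    rw [Finset.mem_Ioo] at hv
    rw [h none v (Finset.mem_Ico.2 (by omega))]
  · unfold advCount
    congr 1
    refine Finset.filter_congr fun t ht => exists_congr fun i => ?_
    rw [h _ t ht]

lemma setOf_isIsolated {Ω : Type v} {Z : Option (Fin n) × ℕ → Ω → ℕ} {Δ t : ℕ} (hΔ : 1 ≤ Δ) (ht : Δ ≤ t) :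
    {ω | IsIsolated Δ t fun x => Z x ω} =
      ⋂ v ∈ Finset.Ioo (t - Δ) (t + Δ), Z (none, v) ⁻¹' (if v = t then {1} else {0}) := by
  ext ω
  simp only [IsIsolated, Set.mem_ofPred_eq, Set.mem_iInter, Set.mem_preimage]
  constructor
  · rintro ⟨h1, h2⟩ v hv
    split_ifs with h
    · rw [h]; exact h1
    · exact h2 v hv h
  · intro h
    refine ⟨?_, fun v hv hne => ?_⟩
    · simpa using h t (Finset.mem_Ioo.2 (by omega))
    · simpa [hne] using h v hv

variable {Ω : Type v} [MeasurableSpace Ω] {μ : Measure Ω}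

lemma integrable_card_filter [IsProbabilityMeasure μ] (U : Finset ℕ) {P : ℕ → Ω → Prop} [∀ t ω, Decidable (P t ω)]
    (hP : ∀ t ∈ U, MeasurableSet {ω | P t ω}) :
    Integrable (fun ω => ((U.filter fun t => P t ω).card : ℝ)) μ ∧
      ∫ ω, ((U.filter fun t => P t ω).card : ℝ) ∂μ = ∑ t ∈ U, μ.real {ω | P t ω} := by
  have h : (fun ω => ((U.filter fun t => P t ω).card : ℝ)) =
      fun ω => ∑ t ∈ U, {ω | P t ω}.indicator (1 : Ω → ℝ) ω := by
    ext ω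
    rw [Finset.card_filter]
    push_cast
    refine Finset.sum_congr rfl fun t _ => ?_
    simp [Set.indicator_apply]
  have hi : ∀ t ∈ U, Integrable ({ω | P t ω}.indicator (1 : Ω → ℝ)) μ := fun t ht =>
    (integrable_const (1 : ℝ)).indicator (hP t ht)
  rw [h]
  refine ⟨integrable_finsetSum _ hi, ?_⟩
  rw [integral_finsetSum _ hi]
  exact Finset.sum_congr rfl fun t ht => integral_indicator_one (hP t ht)

variable {Z : Option (Fin n) × ℕ → Ω → ℕ} {z₀ z₁ : ℝ}

lemma measurableSet_isIsolated (hZ : ∀ x, Measurable (Z x)) {Δ t : ℕ} (hΔ : 1 ≤ Δ) (ht : Δ ≤ t) :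
    MeasurableSet {ω | IsIsolated Δ t fun x => Z x ω} := by
  rw [setOf_isIsolated hΔ ht]
  exact Finset.measurableSet_biInter _ fun v _ => hZ _ (Set.to_countable _).measurableSet

/-- By independence the probability is a product: one index with outcome `1` and `2 * Δ - 2`
neighbours with outcome `0`. -/
lemma le_measure_isIsolated (hind : iIndepFun Z μ) (hz₀ : 0 ≤ z₀)
    (h0 : ∀ t, z₀ ≤ μ.real (Z (none, t) ⁻¹' {0})) (h1 : ∀ t, z₁ ≤ μ.real (Z (none, t) ⁻¹' {1}))
    {Δ t : ℕ} (hΔ : 1 ≤ Δ) (ht : Δ ≤ t) :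
    z₁ * z₀ ^ (2 * Δ - 2) ≤ μ.real {ω | IsIsolated Δ t fun x => Z x ω} := by
  have hi : iIndepFun (fun v : ℕ => Z (none, v)) μ :=
    hind.precomp (g := fun v : ℕ => (none, v)) fun a b h => (Prod.mk.inj h).2
  have := hi.measure_inter_preimage_eq_mul (Finset.Ioo (t - Δ) (t + Δ))
    (sets := fun v => if v = t then {1} else {0}) fun _ _ => (Set.to_countable _).measurableSet
  have htm : t ∈ Finset.Ioo (t - Δ) (t + Δ) := Finset.mem_Ioo.2 (by omega)
  rw [setOf_isIsolated hΔ ht, Measure.real, this, ENNReal.toReal_prod,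
    ← Finset.mul_prod_erase _ _ htm, if_pos rfl]
  refine mul_le_mul (h1 t) ?_ (by positivity) ENNReal.toReal_nonneg
  have hcard : ((Finset.Ioo (t - Δ) (t + Δ)).erase t).card = 2 * Δ - 2 := by
    rw [Finset.card_erase_of_mem htm, Nat.card_Ioo]
    omega
  rw [← hcard, ← Finset.prod_const]
  refine Finset.prod_le_prod (fun _ _ => hz₀) fun v hv => ?_
  rw [if_neg (Finset.ne_of_mem_erase hv)]
  exact h0 v

lemma le_integral_convCount [IsProbabilityMeasure μ] (hZ : ∀ x, Measurable (Z x)) (hind : iIndepFun Z μ)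
    (hz₀ : 0 ≤ z₀)
    (h0 : ∀ t, z₀ ≤ μ.real (Z (none, t) ⁻¹' {0})) (h1 : ∀ t, z₁ ≤ μ.real (Z (none, t) ⁻¹' {1}))
    {Δ B : ℕ} (hΔ : 1 ≤ Δ) (hB : 2 * Δ ≤ B) (m : ℕ) :
    Integrable (fun ω => (convCount Δ B m fun x => Z x ω : ℝ)) μ ∧
      (B - 2 * Δ : ℝ) * (z₁ * z₀ ^ (2 * Δ - 2)) ≤
        ∫ ω, (convCount Δ B m fun x => Z x ω : ℝ) ∂μ := by
  classical
  obtain ⟨hint, heq⟩ := integrable_card_filter (μ := μ) (Finset.Ico (m * B + Δ) ((m + 1) * B - Δ))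
    (P := fun t ω => IsIsolated Δ t fun x => Z x ω) fun t ht =>
      measurableSet_isIsolated hZ hΔ (by rw [Finset.mem_Ico] at ht; omega)
  have hc : ∀ ω, convCount Δ B m (fun x => Z x ω) = ((Finset.Ico (m * B + Δ)
      ((m + 1) * B - Δ)).filter fun t => IsIsolated Δ t fun x => Z x ω).card := fun ω => by
    unfold convCount; congr
  simp_rw [hc]
  refine ⟨hint, ?_⟩
  rw [heq]
  have hsum := Finset.card_nsmul_le_sum (Finset.Ico (m * B + Δ) ((m + 1) * B - Δ)) _ _ fun t ht =>
    le_measure_isIsolated hind hz₀ h0 h1 hΔ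
      (show Δ ≤ t by rw [Finset.mem_Ico] at ht; omega)
  refine le_trans (le_of_eq ?_) hsum
  have : (Finset.Ico (m * B + Δ) ((m + 1) * B - Δ)).card = B - 2 * Δ := by
    rw [Nat.card_Ico, Nat.succ_mul]
    omega
  rw [this, nsmul_eq_mul, Nat.cast_sub hB]
  push_cast
  ring

lemma integral_advCount_le [IsProbabilityMeasure μ] (hZ : ∀ x, Measurable (Z x)) {corrupt : Finset (Fin n)}
    (hc : ∀ i ∉ corrupt, ∀ t ω, Z (some i, t) ω = 0) {p : ℝ}
    (h1 : ∀ i t, μ.real (Z (some i, t) ⁻¹' {1}) ≤ p) (B m : ℕ) :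
    Integrable (fun ω => (advCount B m fun x => Z x ω : ℝ)) μ ∧
      ∫ ω, (advCount B m fun x => Z x ω : ℝ) ∂μ ≤ B * (corrupt.card * p) := by
  classical
  have hset : ∀ t, {ω | ∃ i, Z (some i, t) ω = 1} = ⋃ i ∈ corrupt, Z (some i, t) ⁻¹' {1} := by
    intro t
    ext ω
    simp only [Set.mem_ofPred_eq, Set.mem_iUnion, Set.mem_preimage, Set.mem_singleton_iff,
      exists_prop]
    refine exists_congr fun i => ⟨fun h => ⟨?_, h⟩, fun h => h.2⟩
    by_contra hi
    rw [hc i hi] at h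
    exact zero_ne_one h
  obtain ⟨hint, heq⟩ := integrable_card_filter (μ := μ) (Finset.Ico (m * B) ((m + 1) * B))
    (P := fun t ω => ∃ i, Z (some i, t) ω = 1) fun t _ => by
      rw [hset]
      exact Finset.measurableSet_biUnion _ fun i _ => hZ _ (measurableSet_singleton _)
  have hc' : ∀ ω, advCount B m (fun x => Z x ω) = ((Finset.Ico (m * B)
      ((m + 1) * B)).filter fun t => ∃ i, Z (some i, t) ω = 1).card := fun ω => by
    unfold advCount; congr
  simp_rw [hc']
  refine ⟨hint, ?_⟩
  rw [heq]
  refine (Finset.sum_le_card_nsmul _ _ (corrupt.card * p) fun t _ => ?_).trans (le_of_eq ?_)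
  · rw [hset]
    refine (measureReal_biUnion_finset_le _ _).trans
      ((Finset.sum_le_sum fun i _ => h1 i t).trans (le_of_eq ?_))
    rw [Finset.sum_const, nsmul_eq_mul]
  · rw [Nat.card_Ico, Nat.succ_mul, Nat.add_sub_cancel_left, nsmul_eq_mul]

/-- A block without adversarial wins and with an isolated honest win has positive probability. -/
lemma le_measure_perfect [IsProbabilityMeasure μ] (hind : iIndepFun Z μ) {q : ℝ} (hq : 0 ≤ q)
    (h0 : ∀ x, q ≤ μ.real (Z x ⁻¹' {0})) (h1 : ∀ t, q ≤ μ.real (Z (none, t) ⁻¹' {1}))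
    {Δ B : ℕ} (hB : 2 * Δ + 1 ≤ B) (m : ℕ) :
    q ^ ((n + 1) * B) ≤ μ.real {ω | (advCount B m fun x => Z x ω) = 0 ∧
      1 ≤ convCount Δ B m fun x => Z x ω} := by
  classical
  set U : Finset (Option (Fin n) × ℕ) := Finset.univ ×ˢ Finset.Ico (m * B) ((m + 1) * B) with hU
  have hcard : U.card = (n + 1) * B := by
    rw [hU, Finset.card_product, Finset.card_univ, Fintype.card_option, Fintype.card_fin,
      Nat.card_Ico, Nat.succ_mul m, Nat.add_sub_cancel_left]
  -- One explicit outcome of the whole block: the honest win at index `m * B + Δ`, the first one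
  -- counted, and `0` everywhere else.
  have := hind.measure_inter_preimage_eq_mul U
    (sets := fun x => if x = (none, m * B + Δ) then {1} else {0})
    fun _ _ => (Set.to_countable _).measurableSet
  have hmono : q ^ ((n + 1) * B) ≤ μ.real (⋂ x ∈ U, Z x ⁻¹'
      (if x = (none, m * B + Δ) then {1} else {0})) := by
    rw [Measure.real, this, ENNReal.toReal_prod, ← hcard, ← Finset.prod_const]
    refine Finset.prod_le_prod (fun _ _ => hq) fun x _ => ?_
    split_ifs with h
    · rw [h]; exact h1 _
    · exact h0 x
  refine hmono.trans (measureReal_mono ?_)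
  intro ω hω
  have hr : (m + 1) * B = m * B + B := Nat.succ_mul _ _
  simp only [Set.mem_iInter, Set.mem_preimage, hU, Finset.mem_product, Finset.mem_univ, true_and,
    Finset.mem_Ico] at hω
  constructor
  · unfold advCount
    rw [Finset.card_eq_zero, Finset.filter_eq_empty_iff]
    rintro t ht ⟨i, hi⟩
    have := hω (some i, t) (Finset.mem_Ico.1 ht)
    rw [if_neg (by simp)] at this
    exact zero_ne_one ((Set.mem_singleton_iff.1 this).symm.trans hi)
  · refine Finset.card_pos.2 ⟨m * B + Δ, Finset.mem_filter.2 ⟨Finset.mem_Ico.2 (by omega), ?_, ?_⟩⟩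
    · have := hω (none, m * B + Δ) (by dsimp only; omega)
      simpa using this
    · intro v hv hne
      rw [Finset.mem_Ioo] at hv
      have := hω (none, v) (by dsimp only; omega)
      simpa [hne] using this

end Counts

/-! ### Probabilities of the tickets -/

namespace IsLottery

variable {n : ℕ} {Ω : Type v} [mΩ : MeasurableSpace Ω] {μ : Measure Ω} [IsProbabilityMeasure μ]
  {corrupt : Finset (Fin n)} {p : ℝ} {F : Filtration ℕ mΩ} {win : Ω → Fin n → ℕ → Prop}
  {A : Ω → ℕ → Finset (Fin n)} {h : ℕ}

/-- The law is that for any fixed set of `h` honest nodes; bounding the number of honest nodes by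
`n` makes the exponents uniform over all adversaries. -/
lemma le_measure_ticket_none (hL : IsLottery μ corrupt p F win) (hp₀ : 0 ≤ p) (hp₁ : p ≤ 1)
    (hA : ∀ t i, MeasurableSet[F t] {ω | i ∈ A ω t})
    (hAc : ∀ ω, ∀ t, 1 ≤ t → Disjoint (A ω t) corrupt)
    (hAh : ∀ ω, ∀ t, 1 ≤ t → h ≤ (A ω t).card) (t : ℕ) :
    (1 - p) ^ n ≤ μ.real (ticket corrupt h A win (none, t) ⁻¹' {0}) ∧
      h * p * (1 - p) ^ n ≤ μ.real (ticket corrupt h A win (none, t) ⁻¹' {1}) := by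
  obtain ⟨ω₀⟩ : Nonempty Ω := nonempty_of_isProbabilityMeasure μ
  set S := pick h (A ω₀ (t + 1)) with hS
  have hSd : Disjoint S corrupt :=
    Finset.disjoint_of_subset_left (pick_subset h _) (hAc ω₀ (t + 1) (by omega))
  have hSh : S.card = h := card_pick (hAh ω₀ (t + 1) (by omega))
  have key : ∀ B, μ (ticket corrupt h A win (none, t) ⁻¹' B) =
      μ ((fun ω => honestOutcome corrupt S fun j => win ω j (t + 1)) ⁻¹' B) := by
    intro B
    have := hL.measure_honestOutcome_inter (t := t + 1) (hA (t + 1)) (fun ω => hAc ω _ (by omega))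
      (fun ω => hAh ω _ (by omega)) hSd hSh B MeasurableSet.univ
    rwa [Set.inter_univ, measure_univ, mul_one] at this
  have hQ : (1 - ENNReal.ofReal p).toReal = 1 - p := by
    rw [ENNReal.toReal_sub_of_le (by simpa using hp₁) ENNReal.one_ne_top, ENNReal.toReal_ofReal hp₀,
      ENNReal.toReal_one]
  have hle : corruptᶜ.card ≤ n := by simpa using Finset.card_le_univ corruptᶜ
  have h1p : 0 ≤ 1 - p := by linarith
  constructor
  · rw [Measure.real, key, hL.measure_noWinner, ENNReal.toReal_pow, hQ]
    exact pow_le_pow_of_le_one h1p (by linarith) hle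
  · rw [Measure.real, key, hL.measure_uniqueWinner hSd, hSh, ENNReal.toReal_mul, ENNReal.toReal_mul,
      ENNReal.toReal_pow, hQ, ENNReal.toReal_ofReal hp₀, ENNReal.toReal_natCast, mul_assoc]
    exact mul_le_mul_of_nonneg_left (mul_le_mul_of_nonneg_left
      (pow_le_pow_of_le_one h1p (by linarith) (by omega)) hp₀) (Nat.cast_nonneg _)

lemma measure_ticket_some (hL : IsLottery μ corrupt p F win) (hp₀ : 0 ≤ p)
    (i : Fin n) (t : ℕ) :
    μ.real (ticket corrupt h A win (some i, t) ⁻¹' {1}) ≤ p ∧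
      1 - p ≤ μ.real (ticket corrupt h A win (some i, t) ⁻¹' {0}) := by
  have hw : μ.real {ω | win ω i (t + 1)} = p := by
    rw [Measure.real, hL.prob, ENNReal.toReal_ofReal hp₀]
  constructor
  · rw [← hw]
    refine measureReal_mono fun ω hω => ?_
    simp only [ticket, Set.mem_preimage, Set.mem_singleton_iff] at hω
    split_ifs at hω with hc
    exact hc.2
  · rw [← hw, ← probReal_compl_eq_one_sub (hL.measurableSet_win i (t + 1))]
    refine measureReal_mono fun ω hω => ?_
    simp only [ticket, Set.mem_preimage, Set.mem_singleton_iff]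
    rw [if_neg fun hc => hω hc.2]

end IsLottery

/-! ### Independent block counts of a run -/

section Run

variable {n : ℕ} {Tx : Type u} {Ω : Type v}

open Classical in
-- Index `t` stands for slot `t + 1`. A unique winner among the chosen awake nodes is awake, and
-- outcome `0` excludes sleeping honest winners too. Unique awake winners outside the chosen set are
-- lost, hence only an inequality.
lemma convCount_ticket_le {corrupt : Finset (Fin n)} {win : Ω → Fin n → ℕ → Prop}
    {E : Ω → Execution n Tx} {h Δ B m : ℕ} {ω : Ω} (hE : ∀ t, Disjoint ((E ω).awake t) corrupt) :
    (convCount Δ B m fun x => ticket corrupt h (fun ω => (E ω).awake) win x ω) ≤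
      ((Finset.Ioc (m * B) ((m + 1) * B)).filter
        (IsConvergence corrupt Δ (win ω) (E ω))).card := by
  refine Finset.card_le_card_of_injOn (fun t => t + 1) ?_ fun a _ b _ hab => Nat.succ_injective hab
  intro t ht
  simp only [Finset.coe_filter, Finset.mem_Ico, Finset.mem_Ioc, Set.mem_ofPred_eq] at ht ⊢
  obtain ⟨ht, h1, h2⟩ := ht
  refine ⟨by omega, ?_⟩
  simp only [ticket] at h1 h2
  rw [honestOutcome_eq_one (Finset.disjoint_of_subset_left (pick_subset _ _) (hE _))] at h1
  obtain ⟨i, hi, hw⟩ := h1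
  have hi' := pick_subset _ _ hi
  have hic := Finset.disjoint_left.1 (hE _) hi'
  refine ⟨i, hi', (hw i hic).2 rfl, fun j hj s hs1 hs2 hwin => ?_⟩
  by_cases hst : s = t + 1
  · exact ⟨(hw j hj).1 (hst ▸ hwin), hst⟩
  · have := h2 (s - 1) (Finset.mem_Ioo.2 (by omega)) (by omega)
    rw [honestOutcome_eq_zero, Nat.sub_add_cancel (by omega)] at this
    exact absurd hwin (this j hj)

open Classical in
lemma card_advSlot_le {corrupt : Finset (Fin n)} {win : Ω → Fin n → ℕ → Prop}
    {A : Ω → ℕ → Finset (Fin n)} {h B m : ℕ} {ω : Ω} :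
    ((Finset.Ioc (m * B) ((m + 1) * B)).filter (IsAdvSlot corrupt (win ω))).card ≤
      advCount B m fun x => ticket corrupt h A win x ω := by
  refine Finset.card_le_card_of_injOn (fun t => t - 1) ?_ ?_
  · intro t ht
    simp only [Finset.coe_filter, Finset.mem_Ico, Finset.mem_Ioc, Set.mem_ofPred_eq] at ht ⊢
    obtain ⟨ht, i, hi, hw⟩ := ht
    refine ⟨by omega, i, ?_⟩
    simp only [ticket]
    rw [Nat.sub_add_cancel (by omega), if_pos ⟨hi, hw⟩]
  · intro a ha b hb hab
    simp only [Finset.coe_filter, Finset.mem_Ioc, Set.mem_ofPred_eq] at ha hb hab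
    omega

variable [mΩ : MeasurableSpace Ω] {μ : Measure Ω} [IsProbabilityMeasure μ]
  {corrupt : Finset (Fin n)} {β p : ℝ} {Δ k : ℕ}
  {F : Filtration ℕ mΩ} {win : Ω → Fin n → ℕ → Prop} {E : Ω → Execution n Tx}

/-- The number of awake honest nodes is bounded below by a constant that is large enough compared
to the number of adversarial nodes. -/
lemma IsSyncDynamicRun.exists_min_awake (hrun : IsSyncDynamicRun μ corrupt β p Δ k F win E) :
    ∃ h : ℕ, 1 ≤ h ∧ (corrupt.card : ℝ) ≤ β * (corrupt.card + h) ∧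
      ∀ ω, ∀ t, 1 ≤ t → h ≤ ((E ω).awake t).card := by
  classical
  obtain ⟨ω₀⟩ : Nonempty Ω := nonempty_of_isProbabilityMeasure μ
  have hex : ∀ ω t, 1 ≤ t → 1 ≤ ((E ω).awake t).card ∧
      (corrupt.card : ℝ) ≤ β * (corrupt.card + ((E ω).awake t).card) := fun ω t ht =>
    ⟨Finset.card_pos.2 (hrun.participation ω t ht).1, (hrun.participation ω t ht).2⟩
  have hP : ∃ h : ℕ, 1 ≤ h ∧ (corrupt.card : ℝ) ≤ β * (corrupt.card + h) :=
    ⟨_, hex ω₀ 1 le_rfl⟩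
  -- Every awake count satisfies the participation condition, so the least number satisfying it
  -- bounds all of them from below and still satisfies it.
  exact ⟨Nat.find hP, (Nat.find_spec hP).1, (Nat.find_spec hP).2,
    fun ω t ht => Nat.find_min' hP (hex ω t ht)⟩

open Classical in
/-- Independent block counts that bound the numbers of convergence opportunities and adversarial
slots in blocks of `B` slots. -/
theorem IsSyncDynamicRun.exists_counts (hrun : IsSyncDynamicRun μ corrupt β p Δ k F win E)
    (hΔ : 1 ≤ Δ) (hβ : β < 1) (hp₀ : 0 < p) (hnp : 2 * Δ * n * p ≤ 1) (hn : 1 ≤ n) {ε : ℝ}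
    (hε : β / (1 - β) + ε ≤ 1 - 2 * Δ * n * p) (hε₀ : 0 ≤ ε) {B : ℕ} (hB : 2 * Δ + 1 ≤ B)
    (hBε : 1 + 2 * Δ ≤ B * (p * ε)) :
    ∃ Y : ℕ → Ω → ℕ × ℕ, (∀ m, Measurable (Y m)) ∧ iIndepFun Y μ ∧
      (∀ m ω, (Y m ω).1 ≤ B ∧ (Y m ω).2 ≤ B) ∧
      (∀ m, 1 ≤ ∫ ω, (((Y m ω).1 : ℝ) - (Y m ω).2) ∂μ) ∧
      (∀ m, (p * (1 - p) ^ n) ^ ((n + 1) * B) ≤ μ.real {ω | (Y m ω).2 = 0 ∧ 1 ≤ (Y m ω).1}) ∧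
      ∀ m ω, (Y m ω).1 ≤ ((Finset.Ioc (m * B) ((m + 1) * B)).filter
          (IsConvergence corrupt Δ (win ω) (E ω))).card ∧
        ((Finset.Ioc (m * B) ((m + 1) * B)).filter
          (IsAdvSlot corrupt (win ω))).card ≤ (Y m ω).2 := by
  obtain ⟨h, hh1, hhf, hAh⟩ := hrun.exists_min_awake
  have hL := hrun.lottery
  set A : Ω → ℕ → Finset (Fin n) := fun ω => (E ω).awake with hAdef
  have hA := hrun.awake_causal
  have hdisj : ∀ ω t, Disjoint (A ω t) corrupt := fun ω t =>
    Finset.disjoint_left.2 fun i hi => (hrun.execution ω).awake_honest t i hi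
  have hAc : ∀ ω, ∀ t, 1 ≤ t → Disjoint (A ω t) corrupt := fun ω t _ => hdisj ω t
  set Z := ticket corrupt h A win with hZdef
  have hZm : ∀ x, Measurable (Z x) := hL.measurable_ticket hA
  have hind : iIndepFun Z μ := hL.iIndepFun_ticket hA hAc hAh
  have hΔ' : (1 : ℝ) ≤ Δ := by exact_mod_cast hΔ
  have hn' : (1 : ℝ) ≤ n := by exact_mod_cast hn
  have hh1' : (1 : ℝ) ≤ h := by exact_mod_cast hh1
  have hnp1 : (n : ℝ) * p ≤ 1 := by
    nlinarith [mul_nonneg (by linarith : (0 : ℝ) ≤ Δ - 1) (by positivity : 0 ≤ (n : ℝ) * p)]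
  have hp₁ : p ≤ 1 := by nlinarith
  have h1p : 0 ≤ 1 - p := by linarith
  have h1p' : 1 - p ≤ 1 := by linarith
  have hnone := hL.le_measure_ticket_none hp₀.le hp₁ hA hAc hAh
  have hsome := hL.measure_ticket_some (h := h) (A := A) hp₀.le
  have hz : (0 : ℝ) ≤ (1 - p) ^ n := by positivity
  have hz1 : (1 - p) ^ n ≤ 1 := pow_le_one₀ h1p h1p'
  have hq : p * (1 - p) ^ n ≤ (1 - p) ^ n := mul_le_of_le_one_left hz hp₁
  refine ⟨fun m ω => (convCount Δ B m fun x => Z x ω, advCount B m fun x => Z x ω),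
    fun m => measurable_of_dependsOn hZm (dependsOn_counts Δ B m),
    iIndepFun_of_dependsOn hZm hind ?_ (dependsOn_counts Δ B),
    fun m ω => by exact ⟨convCount_le _ _ _ _, advCount_le B m fun x => Z x ω⟩, fun m => ?_, fun m => ?_,
    fun m ω => ⟨convCount_ticket_le (hdisj ω), card_advSlot_le⟩⟩
  · intro m m' hne
    refine Finset.disjoint_left.2 fun x hx hx' => hne ?_
    simp only [Finset.mem_product, Finset.mem_univ, true_and, Finset.mem_Ico, Nat.succ_mul] at hx hx'
    have e1 : x.2 / B = m := (Nat.div_eq_iff (by omega)).2 (by omega)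
    have e2 : x.2 / B = m' := (Nat.div_eq_iff (by omega)).2 (by omega)
    omega
  · obtain ⟨hi1, hc⟩ := le_integral_convCount hZm hind hz (fun t => (hnone t).1)
      (fun t => (hnone t).2) hΔ (by omega : 2 * Δ ≤ B) m
    obtain ⟨hi2, ha⟩ := integral_advCount_le (μ := μ) hZm (corrupt := corrupt) (fun i hi t ω => by
      simp only [hZdef, ticket]; rw [if_neg fun h => hi h.1]) (fun i t => (hsome i t).1) B m
    rw [integral_sub hi1 hi2]
    -- Bernoulli's inequality with exponent `n * (2 * Δ - 1)`, at most `2 * Δ * n`.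
    have hbern : 1 - 2 * Δ * n * p ≤ (1 - p) ^ n * ((1 - p) ^ n) ^ (2 * Δ - 2) := by
      rw [← pow_succ', ← pow_mul]
      have hb := one_add_mul_le_pow (show (-2 : ℝ) ≤ -p by linarith) (n * (2 * Δ - 2 + 1))
      rw [← sub_eq_add_neg] at hb
      refine le_trans ?_ hb
      have hle : ((n * (2 * Δ - 2 + 1) : ℕ) : ℝ) ≤ 2 * Δ * n := by
        have : n * (2 * Δ - 2 + 1) ≤ n * (2 * Δ) := Nat.mul_le_mul_left _ (by omega)
        calc ((n * (2 * Δ - 2 + 1) : ℕ) : ℝ) ≤ ((n * (2 * Δ) : ℕ) : ℝ) := by exact_mod_cast this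
          _ = 2 * Δ * n := by push_cast; ring
      nlinarith
    set L := h * p * (1 - 2 * Δ * n * p) with hLdef
    have hL1 : L ≤ h * p * (1 - p) ^ n * ((1 - p) ^ n) ^ (2 * Δ - 2) := by
      rw [mul_assoc (h * p)]
      exact mul_le_mul_of_nonneg_left hbern (by positivity)
    have hhn : (h : ℝ) ≤ n := by
      obtain ⟨ω₀⟩ : Nonempty Ω := nonempty_of_isProbabilityMeasure μ
      have h1 := hAh ω₀ 1 le_rfl
      have h2 := Finset.card_le_univ ((E ω₀).awake 1)
      rw [Fintype.card_fin] at h2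
      exact_mod_cast h1.trans h2
    have hhp : (h : ℝ) * p ≤ 1 := (mul_le_mul_of_nonneg_right hhn hp₀.le).trans hnp1
    have hL2 : L ≤ 1 := by
      have : 1 - 2 * (Δ : ℝ) * n * p ≤ 1 := by
        have : 0 ≤ 2 * (Δ : ℝ) * n * p := by positivity
        linarith
      calc L ≤ h * p * 1 := mul_le_mul_of_nonneg_left this (by positivity)
        _ ≤ 1 := by linarith
    have hfh : (corrupt.card : ℝ) ≤ β / (1 - β) * h := by
      rw [div_mul_eq_mul_div, le_div_iff₀ (by linarith)]
      linarith
    have hL3 : corrupt.card * p + p * ε ≤ L := by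
      have e1 : corrupt.card * p ≤ β / (1 - β) * h * p := mul_le_mul_of_nonneg_right hfh hp₀.le
      have e2 : h * p * (β / (1 - β) + ε) ≤ L := mul_le_mul_of_nonneg_left hε (by positivity)
      have e3 : p * ε ≤ h * (p * ε) := le_mul_of_one_le_left (by positivity) hh1'
      nlinarith
    have hBΔ : (0 : ℝ) ≤ B - 2 * Δ := by
      have : ((2 * Δ + 1 : ℕ) : ℝ) ≤ B := by exact_mod_cast hB
      push_cast at this
      linarith
    have e4 := mul_le_mul_of_nonneg_left hL1 hBΔ
    have e5 : (B : ℝ) * (corrupt.card * p + p * ε) ≤ B * L :=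
      mul_le_mul_of_nonneg_left hL3 (Nat.cast_nonneg _)
    have e6 : 2 * (Δ : ℝ) * L ≤ 2 * Δ := mul_le_of_le_one_right (by positivity) hL2
    -- The mean is at least `(B - 2 * Δ) * L - B * corrupt.card * p ≥ B * p * ε - 2 * Δ * L ≥ 1`, by
    -- `hL3`, `hBε` and `L ≤ 1`.
    nlinarith
  · have hqn : ∀ t, p * (1 - p) ^ n ≤ μ.real (Z (none, t) ⁻¹' {1}) := fun t => by
      refine le_trans ?_ (hnone t).2
      rw [mul_assoc]
      exact le_mul_of_one_le_left (by positivity) hh1'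
    refine le_measure_perfect hind (by positivity) ?_ hqn hB m
    rintro ⟨_ | i, t⟩
    · exact hq.trans (hnone t).1
    · refine (hq.trans ?_).trans (hsome i t).2
      exact (pow_le_pow_of_le_one h1p h1p' hn).trans_eq (pow_one _)

end Run

/-! ### Choice of parameters -/

lemma eventually_polynomial_le_exp_sqrt (T : Polynomial ℕ) (C : ℝ) {c : ℝ} (hc : 0 < c) :
    ∀ᶠ σ : ℕ in atTop, C * ((T.eval σ : ℕ) + 1 : ℝ) ^ 2 ≤ Real.exp (c * Real.sqrt σ) := by
  set P : Polynomial ℝ := Polynomial.C C * (T.map (Nat.castRingHom ℝ) + 1) ^ 2 with hP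
  -- In terms of `y = c * √σ` one has `σ = y ^ 2 / c ^ 2`, so the left side is a polynomial in `y`,
  -- to be compared with `exp y`.
  set Q : Polynomial ℝ := P.comp (Polynomial.C ((c ^ 2)⁻¹) * Polynomial.X ^ 2) with hQ
  have hlim := (Polynomial.tendsto_div_exp_atTop Q).comp
    ((Real.tendsto_sqrt_atTop.comp tendsto_natCast_atTop_atTop).const_mul_atTop hc)
  filter_upwards [hlim.eventually (gt_mem_nhds zero_lt_one)] with σ hσ
  have heval : Q.eval (c * Real.sqrt σ) = C * ((T.eval σ : ℕ) + 1 : ℝ) ^ 2 := by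
    have h1 : (c ^ 2)⁻¹ * (c * Real.sqrt σ) ^ 2 = ((σ : ℕ) : ℝ) := by
      rw [mul_pow, Real.sq_sqrt (Nat.cast_nonneg _)]
      field_simp
    have h2 : (T.map (Nat.castRingHom ℝ)).eval ((σ : ℕ) : ℝ) = ((T.eval σ : ℕ) : ℝ) := by
      simp
    simp [hQ, hP, Polynomial.eval_comp, h1, h2]
  simp only [Function.comp_apply, heval] at hσ
  rw [div_lt_one (Real.exp_pos _)] at hσ
  exact hσ.le

lemma exists_pivot_of_blockPivots {n : ℕ} {Tx : Type u} {corrupt : Finset (Fin n)} {Δ : ℕ}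
    {win : Fin n → ℕ → Prop} {E : Execution n Tx} {B H N R k : ℕ} (hB : 1 ≤ B)
    (hk : (N + 1) * ((2 * R + 1) * B) + Δ ≤ k)
    (h : ∀ g₀, (g₀ + N) * (2 * R + 1) ≤ H → ∃ g, g₀ ≤ g ∧ g < g₀ + N ∧
      ∃ s, (g * (2 * R + 1) + R) * B < s ∧ s ≤ (g * (2 * R + 1) + R + 1) * B ∧
        IsPivot corrupt Δ H win E s) :
    ∀ t, k ≤ t → t ≤ H → ∃ s, t < s + k ∧ s + Δ ≤ t ∧ IsPivot corrupt Δ H win E s := by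
  intro t hkt htH
  set W := 2 * R + 1 with hW
  have hWB : 0 < W * B := by positivity
  -- The first group that starts after slot `t - k`. Rounding up costs less than one more group,
  -- which is why `hk` has `N + 1`.
  set g₀ := (t - k) / (W * B) + 1 with hg₀
  have h1 : t - k < g₀ * (W * B) := by
    rw [mul_comm]
    exact Nat.lt_mul_div_succ _ hWB
  have h2 : g₀ * (W * B) ≤ t - k + W * B := by
    rw [hg₀, Nat.succ_mul]
    exact Nat.add_le_add_right (Nat.div_mul_le_self _ _) _
  have h3 : (g₀ + N) * W * B + Δ ≤ t := by
    have e1 : (g₀ + N) * W * B = g₀ * (W * B) + N * (W * B) := by ring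
    have e2 : (N + 1) * (W * B) = N * (W * B) + W * B := by ring
    omega
  have h4 : (g₀ + N) * W ≤ (g₀ + N) * W * B := Nat.le_mul_of_pos_right _ hB
  obtain ⟨g, hg1, hg2, s, hs1, hs2, hs⟩ := h g₀ (by omega)
  refine ⟨s, ?_, ?_, hs⟩
  · have e1 : g₀ * (W * B) ≤ g * (W * B) := Nat.mul_le_mul_right _ hg1
    have e2 : (g * W + R) * B = g * (W * B) + R * B := by ring
    omega
  · have e1 : (g + 1) * W ≤ (g₀ + N) * W := Nat.mul_le_mul_right _ hg2
    have e2 : g * W + R + 1 ≤ (g + 1) * W := by rw [Nat.succ_mul]; omega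
    have e3 : (g * W + R + 1) * B ≤ (g₀ + N) * W * B := Nat.mul_le_mul_right _ (e2.trans e1)
    omega

/-- About `ν * √σ` groups of `2 * √σ + 1` blocks take `2 * ν * B * σ` slots to leading order; the
rest is of order `√σ`. -/
lemma exists_groups_fit {κ ν : ℝ} (hκ : 0 < κ) (hν₀ : 0 ≤ ν) {B : ℕ} (hν : 2 * ν * B < κ) (Δ : ℕ) :
    ∀ᶠ σ : ℕ in atTop,
      (⌊ν * (Nat.sqrt σ : ℝ)⌋₊ + 1) * ((2 * Nat.sqrt σ + 1) * B) + Δ ≤ ⌈κ * (σ : ℝ)⌉₊ := by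
  have hlim : Tendsto (fun σ : ℕ => ((Nat.sqrt σ : ℕ) : ℝ)) atTop atTop := by
    refine tendsto_natCast_atTop_atTop.comp (tendsto_atTop_atTop.2 fun b => ⟨b * b, fun a ha => ?_⟩)
    exact Nat.le_sqrt.2 ha
  have hpos : 0 < κ - 2 * ν * B := by linarith
  filter_upwards [hlim.eventually_ge_atTop 1,
    hlim.eventually_ge_atTop ((ν * B + 3 * B + Δ) / (κ - 2 * ν * B))] with σ h1 h2
  rw [div_le_iff₀ hpos] at h2
  set r : ℝ := ((Nat.sqrt σ : ℕ) : ℝ) with hr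
  have hσ : r * r ≤ σ := by
    rw [hr]; exact_mod_cast Nat.sqrt_le σ
  have hfl : (⌊ν * r⌋₊ : ℝ) ≤ ν * r := Nat.floor_le (by positivity)
  have key : (((⌊ν * r⌋₊ + 1) * ((2 * Nat.sqrt σ + 1) * B) + Δ : ℕ) : ℝ) ≤ κ * σ := by
    push_cast
    rw [← hr]
    have hB0 : (0 : ℝ) ≤ B := Nat.cast_nonneg _
    have hΔ0 : (0 : ℝ) ≤ Δ := Nat.cast_nonneg _
    calc ((⌊ν * r⌋₊ : ℝ) + 1) * ((2 * r + 1) * B) + Δ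
        ≤ (ν * r + 1) * ((2 * r + 1) * B) + Δ := by gcongr
      _ = 2 * ν * B * (r * r) + (ν * B + 2 * B) * r + B + Δ := by ring
      _ ≤ 2 * ν * B * (r * r) + (ν * B + 3 * B + Δ) * r := by nlinarith
      _ ≤ 2 * ν * B * (r * r) + r * (κ - 2 * ν * B) * r := by gcongr
      _ = κ * (r * r) := by ring
      _ ≤ κ * σ := by gcongr
  exact_mod_cast key.trans (Nat.le_ceil _)

/-- Both failure probabilities are dominated by the exponential of the square root. -/
lemma failure_le {H σ : ℕ} {δ η ν M c : ℝ} (hδ : 0 ≤ δ) (hη : 0 ≤ η) (hν : 0 ≤ ν)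
    (hc₁ : 2 * c ≤ δ * ν) (hc₂ : 2 * c ≤ η)
    (hH : (Real.exp (δ * (1 + ν)) + Real.exp (η * (1 + M))) * ((H : ℝ) + 1) ^ 2 ≤
      Real.exp (c * Real.sqrt σ)) :
    ((H : ℝ) + 1) * Real.exp (-(δ * ⌊ν * (Nat.sqrt σ : ℝ)⌋₊)) +
      ((H : ℝ) + 1) ^ 2 * Real.exp (-(η * ((Nat.sqrt σ : ℝ) - M))) ≤
        Real.exp (-c * Real.sqrt σ) := by
  have hr : Real.sqrt σ ≤ (Nat.sqrt σ : ℝ) + 1 := Real.real_sqrt_le_nat_sqrt_succ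
  have hs : 0 ≤ Real.sqrt σ := Real.sqrt_nonneg _
  have hfl : ν * (Nat.sqrt σ : ℝ) < ⌊ν * (Nat.sqrt σ : ℝ)⌋₊ + 1 := Nat.lt_floor_add_one _
  -- Rounding the square root and the product loses at most `1 + ν` in the exponent. The rate `2 *
  -- c` leaves half for absorbing the polynomial and these constants.
  have e1 : Real.exp (-(δ * ⌊ν * (Nat.sqrt σ : ℝ)⌋₊)) ≤
      Real.exp (δ * (1 + ν)) * Real.exp (-(2 * c) * Real.sqrt σ) := by
    rw [← Real.exp_add]
    refine Real.exp_le_exp.2 ?_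
    have h1 := mul_le_mul_of_nonneg_left hfl.le hδ
    have h2 := mul_le_mul_of_nonneg_left hr (mul_nonneg hδ hν)
    have h3 := mul_le_mul_of_nonneg_right hc₁ hs
    nlinarith
  have e2 : Real.exp (-(η * ((Nat.sqrt σ : ℝ) - M))) ≤
      Real.exp (η * (1 + M)) * Real.exp (-(2 * c) * Real.sqrt σ) := by
    rw [← Real.exp_add]
    refine Real.exp_le_exp.2 ?_
    have h2 := mul_le_mul_of_nonneg_left hr hη
    have h3 := mul_le_mul_of_nonneg_right hc₂ hs
    nlinarith
  have hH1 : (1 : ℝ) ≤ (H : ℝ) + 1 := by linarith [Nat.cast_nonneg (α := ℝ) H]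
  have hH2 : (H : ℝ) + 1 ≤ ((H : ℝ) + 1) ^ 2 := by nlinarith
  calc _ ≤ ((H : ℝ) + 1) ^ 2 * (Real.exp (δ * (1 + ν)) * Real.exp (-(2 * c) * Real.sqrt σ)) +
        ((H : ℝ) + 1) ^ 2 * (Real.exp (η * (1 + M)) * Real.exp (-(2 * c) * Real.sqrt σ)) := by
        gcongr
    _ = (Real.exp (δ * (1 + ν)) + Real.exp (η * (1 + M))) * ((H : ℝ) + 1) ^ 2 *
        Real.exp (-(2 * c) * Real.sqrt σ) := by ring
    _ ≤ Real.exp (c * Real.sqrt σ) * Real.exp (-(2 * c) * Real.sqrt σ) := by gcongr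
    _ = Real.exp (-c * Real.sqrt σ) := by
        rw [← Real.exp_add]
        ring_nf

end SnapChat

/-! ### Assembly of the main theorem -/

theorem mainTheorem4 (n Δ : ℕ) (β p κ : ℝ) (T : Polynomial ℕ)
    (hΔ : 1 ≤ Δ) (hβ₀ : 0 ≤ β) (hβ : β < 1 / 2)
    (hp₀ : 0 < p) (hp : p < (1 - 2 * β) / (2 * (Δ : ℝ) * (n : ℝ) * (1 - β)))
    (hκ : 0 < κ) :
    ∃ c : ℝ, 0 < c ∧ ∀ᶠ σ : ℕ in atTop,
      ∀ (Tx : Type u) (Ω : Type v) [mΩ : MeasurableSpace Ω] (μ : Measure Ω)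
        [IsProbabilityMeasure μ] (F : Filtration ℕ mΩ) (corrupt : Finset (Fin n))
        (win : Ω → Fin n → ℕ → Prop) (E : Ω → SnapChat.Execution n Tx),
        SnapChat.IsSyncDynamicRun μ corrupt β p Δ ⌈κ * (σ : ℝ)⌉₊ F win E →
        μ {ω | ¬ SnapChat.FinIsSafePrefix corrupt ⌈κ * (σ : ℝ)⌉₊ (T.eval σ) (E ω)} ≤
          ENNReal.ofReal (Real.exp (-c * Real.sqrt (σ : ℝ))) := by
  have hn : 1 ≤ n := by
    rcases Nat.eq_zero_or_pos n with rfl | h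
    · simp at hp
      linarith
    · exact h
  have hn' : (1 : ℝ) ≤ n := by exact_mod_cast hn
  have hΔ' : (1 : ℝ) ≤ Δ := by exact_mod_cast hΔ
  have h1β : 0 < 1 - β := by linarith
  rw [lt_div_iff₀ (by positivity)] at hp
  set ε : ℝ := 1 - 2 * Δ * n * p - β / (1 - β) with hε
  -- Multiplied by `1 - β`, this is the bound on `p`.
  have hε₀ : 0 < ε := by
    have : (1 - β) * (β / (1 - β)) = β := by field_simp
    by_contra hneg
    nlinarith
  have hnp : 2 * Δ * n * p ≤ 1 := by
    have : 0 ≤ β / (1 - β) := by positivity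
    linarith
  have hp₁ : p < 1 := by
    have : 1 ≤ (Δ : ℝ) * n := by nlinarith
    nlinarith
  obtain ⟨B, hB⟩ := exists_nat_ge (max ((2 * Δ + 1 : ℕ) : ℝ) ((1 + 2 * Δ) / (p * ε)))
  have hB1 : 2 * Δ + 1 ≤ B := by exact_mod_cast (le_max_left _ _).trans hB
  have hB2 : 1 + 2 * Δ ≤ B * (p * ε) :=
    (div_le_iff₀ (by positivity)).1 ((le_max_right _ _).trans hB)
  have hB0 : (0 : ℝ) < B := by
    have : 0 < B := by omega
    exact_mod_cast this
  have hq : 0 < (p * (1 - p) ^ n) ^ ((n + 1) * B) := by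
    have : 0 < 1 - p := by linarith
    positivity
  obtain ⟨M, δ, η, hδ, hη, hmain⟩ :=
    SnapChat.exists_measure_no_blockPivot_le.{v} B (by omega) _ hq
  -- Any `ν` with `0 < ν` and `2 * ν * B < κ` would do; this one uses half of the available slots to
  -- leading order.
  set ν : ℝ := κ / (4 * B) with hν
  have hν₀ : 0 < ν := by positivity
  have hνB : 2 * ν * B < κ := by
    have : 2 * ν * B = κ / 2 := by rw [hν]; field_simp; norm_num
    linarith
  set c : ℝ := min (δ * ν) η / 2 with hc
  have hc₀ : 0 < c := by positivity
  have hc₁ : 2 * c ≤ δ * ν := by rw [hc]; linarith [min_le_left (δ * ν) η]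
  have hc₂ : 2 * c ≤ η := by rw [hc]; linarith [min_le_right (δ * ν) η]
  refine ⟨c, hc₀, ?_⟩
  filter_upwards [SnapChat.exists_groups_fit hκ hν₀.le hνB Δ,
    SnapChat.eventually_polynomial_le_exp_sqrt T
      (Real.exp (δ * (1 + ν)) + Real.exp (η * (1 + M))) hc₀,
    -- Ensures `M ≤ R` for `R = Nat.sqrt σ`.
    eventually_ge_atTop (M * M)] with σ hfit hpoly hM
  intro Tx Ω _ μ _ F corrupt win E hrun
  obtain ⟨Y, hYm, hYi, hYB, hYmean, hYq, hYc⟩ := hrun.exists_counts hΔ (by linarith) hp₀ hnp hn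
    (ε := ε) (by rw [hε]; linarith) hε₀.le hB1 hB2
  have hbound := hmain Ω μ Y hYm hYi hYB hYmean hYq (T.eval σ) ⌊ν * (Nat.sqrt σ : ℝ)⌋₊ (Nat.sqrt σ)
    (Nat.le_sqrt.2 hM)
  have hfail := SnapChat.failure_le (H := T.eval σ) hδ.le hη.le hν₀.le hc₁ hc₂ hpoly
  refine (measure_mono ?_).trans ((ENNReal.le_ofReal_iff_toReal_le (measure_ne_top μ _)
    (Real.exp_pos _).le).2 (hbound.trans hfail))
  intro ω hω hgood
  refine hω ((hrun.execution ω).finIsSafePrefix hΔ ((hrun.participation ω).two_mul_card_lt hβ₀ hβ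
    (hrun.execution ω).awake_honest)
    (SnapChat.exists_pivot_of_blockPivots (by omega) hfit fun g₀ hg₀ => ?_))
  obtain ⟨g, h1, h2, h3⟩ := hgood g₀ hg₀
  exact ⟨g, h1, h2, h3.exists_isPivot (by omega) (by omega) (fun m => (hYc m ω).1)
    fun m => (hYc m ω).2⟩
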